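/- **Lemma 3.6 (asymptotic convergence of the hierarchy).** *Notation.* $\mathbb{T}^n=\{z\in\mathbb{C}^n:|z_1|=\dots=|z_n|=1\}$; for $\alpha\in\mathbb{Z}^n$, $\Vert\alpha\Vert_1=\sum_i|\alpha_i|$ and $\mathbf z^\alpha=z_1^{\alpha_1}\cdots z_n^{\alpha_n}$; $\varphi^\alpha:=(\varphi_1^{\alpha_1},\dots,\varphi_n^{\alpha_n})\in\mathbb{T}^n$ for $\varphi\in\mathbb{T}^n$; $\Vert\mu\Vert_{TV}$ is the total variation norm of a finite signed Borel measure $\mu$ on $\mathbb{T}^n$. For a finite set $\Xi=\{\xi_1,\dots,\xi_r\}\subset\mathbb{T}^n$ of $r$ points, a family of interpolation polynomials is a family $u_1,\dots,u_r$ of complex linear combinations of the Laurent monomials $\mathbf z^\alpha$ with $\Vert\alpha\Vert_1\le r-1$ such that $u_i(\xi_j)=\delta_{ij}$; the interpolation entropy $\mathcal{E}(\Xi)$ is the infimum, over all such families, of $\max_{i}\max_{\mathbf z\in\mathbb{T}^n}|u_i(\mathbf z)|^2$ (with $\mathcal{E}(\emptyset)=0$). *Data.* Let $g\in\mathbb{R}[x_1,\dots,x_n]$,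 $g=\sum_\beta g_\beta\mathbf x^\beta$, let $\Gamma=\{\beta\in\mathbb{N}^n: g_\beta\ne0\}$ and $r=|\Gamma|$. Let $\varphi\in\mathbb{T}^n$ be either of the form $\varphi=(e^{2i\pi/N_1},\dots,e^{2i\pi/N_n})$ with nonzero integers $N_i$ such that $|N_i|>\beta_i$ for all $\beta\in\Gamma$ and all $i$, or of the form $\varphi=(e^{2i\pi\theta_1},\dots,e^{2i\pi\theta_n})$ with all $\theta_i\in\mathbb{R}\setminus\mathbb{Q}$. Put $\varphi^\Gamma=\{\varphi^\beta:\beta\in\Gamma\}$ and $\sigma_\alpha=g(\varphi^\alpha)$ for $\alpha\in\mathbb{Z}^n$. For $\mathfrak d\in\mathbb{N}$ consider the super-resolution problem $$\rho_{\mathfrak d}=\inf_{\mu}\Big\{\Vert\mu\Vert_{TV}:\ \int_{\mathbb{T}^n}\mathbf z^\alpha\,d\mu=\sigma_\alpha\ \text{ for all }\alpha\in\mathbb{Z}^n,\ \Vert\alpha\Vert_1\le\mathfrak d\Big\}\qquad(\mathrm{a3})$$ over finite signed Borel measures $\mu$ on $\mathbb{T}^n$, and for integers $d\ge e\ge 0$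 the semidefinite program $$(\mathbf P_{d,e})\qquad \inf_{y^+,y^-}\ y^+_0+y^-_0\quad\text{s.t.}\quad y^+_\gamma-y^-_\gamma=\sigma_\gamma\ \ \forall\gamma\in\mathscr{A}^1_e,\qquad \mathbf T_d(y^+)\succeq0,\ \ \mathbf T_d(y^-)\succeq0,$$ where $\mathscr{A}^1_e=\{\alpha-\beta:\alpha,\beta\in\mathbb{N}^n,\ \Vert\alpha\Vert_1,\Vert\beta\Vert_1\le e\}$, the unknowns $y^\pm=(y^\pm_\gamma)$ are complex vectors indexed by $\gamma\in\mathscr{A}^1_d$, and $\mathbf T_d(y)=(y_{\beta-\alpha})$ with rows $\alpha$ and columns $\beta$ ranging over $\{\alpha\in\mathbb{N}^n:\Vert\alpha\Vert_1\le d\}$. *Claim.* There is a constant $C>0$ depending only on $r$ such that, whenever $\mathfrak d\ge C\,\mathcal{E}(\varphi^\Gamma)$, the following holds. Problem (a3) has a unique optimal solution $\mu^*$; moreover $\mu^*=\sum_{\beta\in\Gamma}g_\beta\,\delta_{\varphi^\beta}$ and $\Vert\mu^*\Vert_{TV}=\sum_{\beta}|g_\beta|$. Let $e\ge\mathfrak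 d$ be any integer (for $n\ge1$ this includes every $e=\tilde{\mathfrak d}$ such that $\{\alpha\in\mathbb{Z}^n:\max_i|\alpha_i|\le\mathfrak d\}\subset\mathscr{A}^1_l$ for all $l\ge\tilde{\mathfrak d}$), and for each $d\ge e$ let $(y^{+,d},y^{-,d})$ be an optimal solution of $(\mathbf P_{d,e})$. Then for every $\alpha\in\mathbb{Z}^n$ $$\lim_{d\to\infty}\big(y^{+,d}_\alpha-y^{-,d}_\alpha\big)=\int_{\mathbb{T}^n}\mathbf z^\alpha\,d\mu^*,$$ where $y^{\pm,d}_\alpha$ is defined for all $d$ large enough. -/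

import Mathlib

open MeasureTheory Filter Topology
open scoped ComplexOrder

namespace SuperRes

/-- The unit circle carries its Borel sigma-algebra (Mathlib declares no measurable structure). -/
noncomputable instance instMeasurableSpaceCircle : MeasurableSpace Circle := borel Circle

instance instBorelSpaceCircle : BorelSpace Circle := ⟨rfl⟩

/-- The `n`-dimensional torus `𝕋ⁿ ⊂ ℂⁿ`, with the product topology and the product (= Borel)
sigma-algebra. -/
abbrev Torus (n : ℕ) : Type := Fin n → Circle

/-- The Laurent monomial `z ↦ z^α`, `α ∈ ℤⁿ`, on the torus. -/
noncomputable def mono {n : ℕ} (α : Fin n → ℤ) (z : Torus n) : ℂ :=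
  ∏ i, (z i : ℂ) ^ α i

/-- The 1-norm `|α₁| + ⋯ + |αₙ|` of a multi-index. -/
def l1 {n : ℕ} (α : Fin n → ℤ) : ℕ := ∑ i, (α i).natAbs

/-- The Laurent polynomials of total degree at most `d`, as functions on the torus: the complex
span of the monomials `z^α` with `‖α‖₁ ≤ d`. -/
def laurentPoly (n d : ℕ) : Submodule ℂ (Torus n → ℂ) :=
  Submodule.span ℂ {f | ∃ α : Fin n → ℤ, l1 α ≤ d ∧ f = mono α}

/-- `u` is a family of interpolation polynomials of the finite set `Ξ`: for each `ξ ∈ Ξ`, `u ξ` is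
a Laurent polynomial of total degree at most `|Ξ| - 1` with value `1` at `ξ` and `0` at the other
points of `Ξ`. -/
def IsInterpolationFamily {n : ℕ} (Ξ : Finset (Torus n)) (u : Torus n → Torus n → ℂ) : Prop :=
  ∀ ξ ∈ Ξ, u ξ ∈ laurentPoly n (Ξ.card - 1) ∧ u ξ ξ = 1 ∧ ∀ η ∈ Ξ, η ≠ ξ → u ξ η = 0

/-- The interpolation entropy `𝓔(Ξ)`: the least value of `max_{ξ ∈ Ξ, z ∈ 𝕋ⁿ} |u_ξ(z)|²` over all
families of interpolation polynomials of `Ξ` (it is `0` for `Ξ = ∅`). -/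
noncomputable def entropy {n : ℕ} (Ξ : Finset (Torus n)) : ℝ :=
  sInf {M : ℝ | 0 ≤ M ∧ ∃ u : Torus n → Torus n → ℂ, IsInterpolationFamily Ξ u ∧
    ∀ ξ ∈ Ξ, ∀ z : Torus n, ‖u ξ z‖ ^ 2 ≤ M}

/-- The two admissible choices of the base point `φ` for a polynomial `g`: either
`φ = (exp(2iπ/N₁), …, exp(2iπ/Nₙ))` with nonzero integers `Nᵢ` that exceed in absolute value all
the exponents of the `i`-th variable in `g`, or `φ = (exp(2iπθ₁), …, exp(2iπθₙ))` with irrational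
`θᵢ`. -/
def IsAdmissible {n : ℕ} (g : MvPolynomial (Fin n) ℝ) (φ : Torus n) : Prop :=
  (∃ N : Fin n → ℤ, (∀ i, N i ≠ 0) ∧ (∀ β ∈ g.support, ∀ i, (β i : ℤ) < |N i|) ∧
    ∀ i, (φ i : ℂ) = Complex.exp (2 * Complex.I * Real.pi / (N i : ℂ))) ∨
  (∃ θ : Fin n → ℝ, (∀ i, Irrational (θ i)) ∧
    ∀ i, (φ i : ℂ) = Complex.exp (2 * Complex.I * Real.pi * (θ i : ℂ)))

/-- The point `φ^β = (φ₁^β₁, …, φₙ^βₙ)` of the torus. -/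
noncomputable def node {n : ℕ} (φ : Torus n) (β : Fin n →₀ ℕ) : Torus n := fun i => φ i ^ β i

open scoped Classical in
/-- The set `φ^Γ = {φ^β : β ∈ Γ}`, where `Γ` is the set of exponents of `g`. -/
noncomputable def nodes {n : ℕ} (g : MvPolynomial (Fin n) ℝ) (φ : Torus n) : Finset (Torus n) :=
  g.support.image (node φ)

/-- The black-box evaluation `σ_α = g(φ^α)`, `α ∈ ℤⁿ`. -/
noncomputable def sigma {n : ℕ} (g : MvPolynomial (Fin n) ℝ) (φ : Torus n) (α : Fin n → ℤ) : ℂ :=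
  MvPolynomial.aeval (fun i => (φ i : ℂ) ^ α i) g

/-- The moment `∫ z^α dμ` of a finite signed Borel measure on the torus. -/
noncomputable def moment {n : ℕ} (μ : SignedMeasure (Torus n)) (α : Fin n → ℤ) : ℂ :=
  ∫ᵛ z, mono α z ∂<•μ

/-- The total variation norm of a signed measure (which is always finite). -/
noncomputable def tvNorm {n : ℕ} (μ : SignedMeasure (Torus n)) : ℝ :=
  (μ.totalVariation Set.univ).toReal

/-- Feasibility for the super-resolution problem: `∫ z^α dμ = σ_α` for all `‖α‖₁ ≤ 𝔡`. -/
def IsFeasibleTV {n : ℕ} (σ : (Fin n → ℤ) → ℂ) (𝔡 : ℕ) (μ : SignedMeasure (Torus n)) : Prop :=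
  ∀ α : Fin n → ℤ, l1 α ≤ 𝔡 → moment μ α = σ α

/-- Optimality for the super-resolution problem: minimal total variation among all feasible
signed measures. -/
def IsOptimalTV {n : ℕ} (σ : (Fin n → ℤ) → ℂ) (𝔡 : ℕ) (μ : SignedMeasure (Torus n)) : Prop :=
  IsFeasibleTV σ 𝔡 μ ∧ ∀ ν : SignedMeasure (Torus n), IsFeasibleTV σ 𝔡 ν → tvNorm μ ≤ tvNorm ν

/-- The atomic measure `∑_{β ∈ Γ} g_β δ_{φ^β}`. -/
noncomputable def atomicMeasure {n : ℕ} (g : MvPolynomial (Fin n) ℝ) (φ : Torus n) :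
    SignedMeasure (Torus n) :=
  ∑ β ∈ g.support, g.coeff β • (Measure.dirac (node φ β)).toSignedMeasure

/-- The multi-indices `α ∈ ℕⁿ` with `‖α‖₁ ≤ d`. -/
abbrev MultiIdx (n d : ℕ) : Type := {α : Fin n → ℕ // ∑ i, α i ≤ d}

/-- The difference `α - β ∈ ℤⁿ` of two multi-indices. -/
def idxSub {n d : ℕ} (α β : MultiIdx n d) : Fin n → ℤ := fun i => (α.1 i : ℤ) - (β.1 i : ℤ)

/-- The Toeplitz-like matrix `T_d(y)`, with rows and columns indexed by `{α ∈ ℕⁿ : ‖α‖₁ ≤ d}` and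
entries `T_d(y)_{α,β} = y_{β-α}`.  It only involves the entries `y_γ` of `y` for which `γ` is a
difference of two such multi-indices. -/
def toeplitz {n : ℕ} (d : ℕ) (y : (Fin n → ℤ) → ℂ) : Matrix (MultiIdx n d) (MultiIdx n d) ℂ :=
  Matrix.of fun α β => y (idxSub β α)

/-- Feasibility of `(y⁺, y⁻)` for the semidefinite program `P_{d,e}`: `y⁺_γ - y⁻_γ = σ_γ` for all
`γ = α - β` with `α, β ∈ ℕⁿ`, `‖α‖₁, ‖β‖₁ ≤ e`, and `T_d(y⁺) ⪰ 0`, `T_d(y⁻) ⪰ 0`.  The sequences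
are indexed by all of `ℤⁿ`; for `e ≤ d`, the entries that do not occur in `T_d` are subject to no
constraint and do not enter the objective. -/
def IsFeasibleSDP {n : ℕ} (σ : (Fin n → ℤ) → ℂ) (d e : ℕ) (yp ym : (Fin n → ℤ) → ℂ) : Prop :=
  (∀ α β : MultiIdx n e, yp (idxSub α β) - ym (idxSub α β) = σ (idxSub α β)) ∧
    (toeplitz d yp).PosSemidef ∧ (toeplitz d ym).PosSemidef

/-- Optimality of `(y⁺, y⁻)` for `P_{d,e}`: it is feasible and minimizes `y⁺₀ + y⁻₀` (a real number
for feasible pairs, since it is a sum of diagonal entries of Hermitian matrices). -/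
def IsOptimalSDP {n : ℕ} (σ : (Fin n → ℤ) → ℂ) (d e : ℕ) (yp ym : (Fin n → ℤ) → ℂ) : Prop :=
  IsFeasibleSDP σ d e yp ym ∧
    ∀ wp wm : (Fin n → ℤ) → ℂ, IsFeasibleSDP σ d e wp wm →
      (yp 0 + ym 0).re ≤ (wp 0 + wm 0).re

end SuperRes

namespace SuperRes

/-! The proof is convex duality with a dual certificate: a real trigonometric polynomial `q` of
degree at most `𝔡` with `|q| ≤ 1`, equal to `1` exactly at the nodes of nonnegative weight and to
`-1` exactly at the others. It is obtained by composing sums of `|u_ξ|²` with a one-variable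
polynomial whose degree is proportional to `r` times the entropy (`exists_certificate`,
`exists_certificate_of_entropy_le`).

The measure problem and the limit of the semidefinite programs are treated at once. Both yield a
pair of positive functionals on Laurent polynomials whose difference has the prescribed moments up
to degree `𝔡`. Pairing with `q` bounds the total mass below by `∑ |g_β|`
(`IsCertificate.sum_abs_le`). In case of equality the functionals vanish on `1 - q` and `1 + q`
respectively, hence on everything vanishing on the nodes. Interpolation at the nodes then expresses
each moment through moments of degree at most `𝔡`, so all moments are determined
(`IsCertificate.eq_atomicMoment`).

For measures, the functionals come from the Jordan decomposition, and moments determine a signed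
measure by Stone–Weierstrass (`signedMeasure_ext_of_moment`). For the programs, they are limits of
optimal solutions along an ultrafilter, and positivity follows from positive semidefinite Toeplitz
matrices of all orders by a Fejér kernel argument (`isPositiveSeq_of_toeplitz_posSemidef`). All such
limits coincide, so the sequence converges. -/

variable {n : ℕ}

/-! ### Laurent polynomials as a filtered star-algebra. -/

lemma mono_zero : mono (0 : Fin n → ℤ) = 1 := by
  ext z; simp [mono]

lemma mono_add (α β : Fin n → ℤ) : mono (α + β) = mono α * mono β := by
  ext z
  simp only [mono, Pi.add_apply, Pi.mul_apply, ← Finset.prod_mul_distrib]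
  exact Finset.prod_congr rfl fun i _ => zpow_add₀ (Circle.coe_ne_zero _) _ _

lemma star_mono (α : Fin n → ℤ) : star (mono α) = mono (-α) := by
  ext z
  simp only [mono, Pi.star_apply, Pi.neg_apply, star_prod, star_zpow₀]
  refine Finset.prod_congr rfl fun i _ => ?_
  rw [zpow_neg, ← inv_zpow, ← Circle.coe_inv, Circle.coe_inv_eq_conj]
  rfl

lemma continuous_mono (α : Fin n → ℤ) : Continuous (mono α) := by
  unfold mono
  refine continuous_finsetProd _ fun i _ => ?_
  exact Continuous.zpow₀ (by fun_prop) _ fun z => Or.inl (Circle.coe_ne_zero _)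

lemma l1_zero : l1 (0 : Fin n → ℤ) = 0 := by simp [l1]

lemma l1_neg (α : Fin n → ℤ) : l1 (-α) = l1 α := by simp [l1]

lemma l1_add_le (α β : Fin n → ℤ) : l1 (α + β) ≤ l1 α + l1 β := by
  simp only [l1, Pi.add_apply, ← Finset.sum_add_distrib]
  exact Finset.sum_le_sum fun i _ => Int.natAbs_add_le _ _

lemma l1_single (i : Fin n) (k : ℤ) : l1 (Pi.single i k) = k.natAbs := by
  rw [l1, Finset.sum_eq_single i] <;> simp +contextual

lemma mono_single (i : Fin n) (k : ℤ) (z : Torus n) : mono (Pi.single i k) z = (z i : ℂ) ^ k := by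
  rw [mono, Finset.prod_eq_single i] <;> simp +contextual

lemma mono_mem_laurentPoly {α : Fin n → ℤ} {d : ℕ} (h : l1 α ≤ d) : mono α ∈ laurentPoly n d :=
  Submodule.subset_span ⟨α, h, rfl⟩

lemma laurentPoly_mono {a b : ℕ} (h : a ≤ b) : laurentPoly n a ≤ laurentPoly n b :=
  Submodule.span_mono fun _ ⟨α, hα, e⟩ => ⟨α, hα.trans h, e⟩

lemma const_mem_laurentPoly (c : ℂ) (d : ℕ) : (fun _ => c) ∈ laurentPoly n d := by
  have := (laurentPoly n d).smul_mem c (mono_mem_laurentPoly (α := 0) (by simp [l1_zero]))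
  rw [mono_zero] at this
  convert this using 1
  ext z; simp

lemma mul_mem_laurentPoly {f g : Torus n → ℂ} {a b : ℕ} (hf : f ∈ laurentPoly n a)
    (hg : g ∈ laurentPoly n b) : f * g ∈ laurentPoly n (a + b) := by
  induction hf using Submodule.span_induction with
  | mem f hf =>
    obtain ⟨α, hα, rfl⟩ := hf
    induction hg using Submodule.span_induction with
    | mem g hg =>
      obtain ⟨β, hβ, rfl⟩ := hg
      rw [← mono_add]
      exact mono_mem_laurentPoly ((l1_add_le _ _).trans (add_le_add hα hβ))
    | zero => simp
    | add g h _ _ hg hh => rw [mul_add]; exact add_mem hg hh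
    | smul c g _ hg => rw [mul_smul_comm]; exact Submodule.smul_mem _ _ hg
  | zero => simp
  | add f h _ _ hf hh => rw [add_mul]; exact add_mem hf hh
  | smul c f _ hf => rw [smul_mul_assoc]; exact Submodule.smul_mem _ _ hf

lemma star_mem_laurentPoly {f : Torus n → ℂ} {a : ℕ} (hf : f ∈ laurentPoly n a) :
    star f ∈ laurentPoly n a := by
  induction hf using Submodule.span_induction with
  | mem f hf =>
    obtain ⟨α, hα, rfl⟩ := hf
    rw [star_mono]
    exact mono_mem_laurentPoly (by rwa [l1_neg])
  | zero => simp
  | add f h _ _ hf hh => rw [star_add]; exact add_mem hf hh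
  | smul c f _ hf => rw [star_smul]; exact Submodule.smul_mem _ _ hf

lemma pow_mem_laurentPoly {f : Torus n → ℂ} {a : ℕ} (hf : f ∈ laurentPoly n a) (k : ℕ) :
    f ^ k ∈ laurentPoly n (a * k) := by
  induction k with
  | zero => exact const_mem_laurentPoly 1 0
  | succ k ih => rw [pow_succ, Nat.mul_succ]; exact mul_mem_laurentPoly ih hf

lemma continuous_of_mem_laurentPoly {f : Torus n → ℂ} {a : ℕ} (hf : f ∈ laurentPoly n a) :
    Continuous f := by
  induction hf using Submodule.span_induction with
  | mem f hf => obtain ⟨α, hα, rfl⟩ := hf; exact continuous_mono α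
  | zero => exact continuous_const
  | add f h _ _ hf hh => exact hf.add hh
  | smul c f _ hf => exact hf.const_smul c

lemma normSq_mem_laurentPoly {f : Torus n → ℂ} {a : ℕ} (hf : f ∈ laurentPoly n a) :
    (fun z => ((‖f z‖ ^ 2 : ℝ) : ℂ)) ∈ laurentPoly n (2 * a) := by
  rw [two_mul]
  convert mul_mem_laurentPoly hf (star_mem_laurentPoly hf) using 1
  ext z
  simp [Complex.mul_conj, Complex.normSq_eq_norm_sq]

/-! ### Construction of the dual certificate. -/

/-- The trigonometric polynomial of degree `1` that peaks exactly at `ξ`. -/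
noncomputable def peak (ξ z : Torus n) : ℝ :=
  (1 + ∑ i, (1 + ((z i : ℂ) * star (ξ i : ℂ)).re) / 2) / (n + 1)

lemma abs_re_mul_star_le (a b : Circle) : |((a : ℂ) * star (b : ℂ)).re| ≤ 1 := by
  refine (Complex.abs_re_le_norm _).trans ?_
  simp [Circle.norm_coe]

lemma peak_nonneg (ξ z : Torus n) : 0 ≤ peak ξ z := by
  refine div_nonneg (add_nonneg zero_le_one (Finset.sum_nonneg fun i _ => ?_)) (by positivity)
  have := abs_le.1 (abs_re_mul_star_le (z i) (ξ i))
  linarith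

lemma peak_le_one (ξ z : Torus n) : peak ξ z ≤ 1 := by
  rw [peak, div_le_one (by positivity)]
  have : ∑ i : Fin n, (1 + ((z i : ℂ) * star (ξ i : ℂ)).re) / 2 ≤ ∑ i : Fin n, (1 : ℝ) :=
    Finset.sum_le_sum fun i _ => by
      have := abs_le.1 (abs_re_mul_star_le (z i) (ξ i))
      linarith
  simp only [Finset.sum_const, Finset.card_univ, Fintype.card_fin, nsmul_eq_mul, mul_one] at this
  linarith

lemma peak_self (ξ : Torus n) : peak ξ ξ = 1 := by
  have h : ∀ i, ((ξ i : ℂ) * star (ξ i : ℂ)).re = 1 := fun i => by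
    simp [Complex.mul_conj]
  rw [peak, div_eq_one_iff_eq (by positivity)]
  simp only [h]
  simp
  ring

lemma eq_of_peak_eq_one {ξ z : Torus n} (h : peak ξ z = 1) : z = ξ := by
  rw [peak, div_eq_one_iff_eq (by positivity), add_comm, add_left_inj] at h
  have h2 : ∑ i : Fin n, (1 + ((z i : ℂ) * star (ξ i : ℂ)).re) / 2 = ∑ i : Fin n, (1 : ℝ) := by
    simpa using h
  rw [Finset.sum_eq_sum_iff_of_le fun i _ => by
      have := abs_le.1 (abs_re_mul_star_le (z i) (ξ i))
      linarith] at h2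
  ext i
  have h3 : ((z i : ℂ) * star (ξ i : ℂ)).re = 1 := by linarith [h2 i (Finset.mem_univ i)]
  -- For unimodular `a`, `b` one has `|a - b|² = 2 - 2 Re(a b̄)`.
  have h4 : ‖(z i : ℂ) - ξ i‖ ^ 2 = 0 := by
    rw [← Complex.normSq_eq_norm_sq, Complex.normSq_sub, Complex.normSq_eq_norm_sq,
      Complex.normSq_eq_norm_sq]
    have : (starRingEnd ℂ) (ξ i : ℂ) = star (ξ i : ℂ) := rfl
    rw [this, h3, Circle.norm_coe, Circle.norm_coe]
    norm_num
  exact sub_eq_zero.1 (norm_eq_zero.1 (pow_eq_zero_iff two_ne_zero |>.1 h4))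

lemma ofReal_re_mem_laurentPoly {f : Torus n → ℂ} {a : ℕ} (hf : f ∈ laurentPoly n a) :
    (fun z => ((f z).re : ℂ)) ∈ laurentPoly n a := by
  convert (laurentPoly n a).smul_mem (1 / 2) (add_mem hf (star_mem_laurentPoly hf)) using 1
  ext z
  simp [Complex.re_eq_add_conj]
  ring

lemma peak_mem_laurentPoly (ξ : Torus n) : (fun z => (peak ξ z : ℂ)) ∈ laurentPoly n 1 := by
  have h : ∀ i, (fun z : Torus n => ((((z i : ℂ) * star (ξ i : ℂ)).re : ℝ) : ℂ))
      ∈ laurentPoly n 1 := fun i => by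
    refine ofReal_re_mem_laurentPoly (f := fun z => (z i : ℂ) * star (ξ i : ℂ)) ?_
    convert (laurentPoly n 1).smul_mem (star (ξ i : ℂ))
      (mono_mem_laurentPoly (α := Pi.single i 1) (by simp [l1_single])) using 1
    ext z
    simp [mono_single, mul_comm]
  convert (laurentPoly n 1).smul_mem (1 / (n + 1)) (add_mem (const_mem_laurentPoly 1 1)
    (sum_mem fun i (_ : i ∈ Finset.univ) => (laurentPoly n 1).smul_mem (1 / 2)
      (add_mem (const_mem_laurentPoly 1 1) (h i)))) using 1
  ext z
  simp only [peak, Pi.smul_apply, Pi.add_apply, Finset.sum_apply, smul_eq_mul]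
  push_cast
  rw [div_eq_inv_mul, one_div]
  congr 2
  exact Finset.sum_congr rfl fun i _ => by ring

/-- A polynomial equal to `1` at `0` that takes values in `[0, 1]` on `[0, R]` and vanishes on
`[0, R)` only at `1`. -/
noncomputable def dip (R : ℝ) (m : ℕ) (t : ℝ) : ℝ := (1 - t) ^ 2 * (1 - t / R) ^ (2 * m)

lemma dip_nonneg (R : ℝ) (m : ℕ) (t : ℝ) : 0 ≤ dip R m t :=
  mul_nonneg (sq_nonneg _) (by rw [pow_mul]; positivity)

lemma dip_zero (R : ℝ) (m : ℕ) : dip R m 0 = 1 := by simp [dip]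

lemma dip_one (R : ℝ) (m : ℕ) : dip R m 1 = 0 := by simp [dip]

lemma eq_one_of_dip_eq_zero {R : ℝ} {m : ℕ} {t : ℝ} (h0 : 0 ≤ t) (ht : t < R)
    (h : dip R m t = 0) : t = 1 := by
  have hR : 0 < R := h0.trans_lt ht
  have : 0 < 1 - t / R := by rw [sub_pos, div_lt_one hR]; exact ht
  rcases mul_eq_zero.1 h with h | h
  · linarith [pow_eq_zero_iff two_ne_zero |>.1 h]
  · exact absurd h (by positivity)

/-- With `x = t / R`, the factor `|1 - t| ≤ 1 + m x` may be large, but Bernoulli bounds it by `(1 +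
x) ^ m`, and `(1 + x)(1 - x) ≤ 1`. This is where `m` must be at least `R`. -/
lemma dip_le_one {R : ℝ} {m : ℕ} {t : ℝ} (hm : R ≤ m) (h0 : 0 ≤ t) (ht : t < R) :
    dip R m t ≤ 1 := by
  have hR : 0 < R := h0.trans_lt ht
  set x := t / R with hx
  have hx0 : 0 ≤ x := by positivity
  have hx1 : x < 1 := by rw [hx, div_lt_one hR]; exact ht
  have hpow : 0 ≤ (1 - x) ^ m := pow_nonneg (by linarith) _
  have htx : t ≤ m * x := by
    rw [hx, mul_div_assoc', le_div_iff₀ hR, mul_comm]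
    gcongr
  have h1 : |(1 - t) * (1 - x) ^ m| ≤ 1 := by
    rw [abs_mul, abs_of_nonneg hpow]
    calc |1 - t| * (1 - x) ^ m ≤ (1 + m * x) * (1 - x) ^ m := by
          gcongr
          rw [abs_le]; constructor <;> linarith
      _ ≤ (1 + x) ^ m * (1 - x) ^ m := by
          gcongr
          exact one_add_mul_le_pow (by linarith) m
      _ = (1 - x ^ 2) ^ m := by rw [← mul_pow]; ring
      _ ≤ 1 := pow_le_one₀ (by nlinarith) (by nlinarith)
  calc dip R m t = ((1 - t) * (1 - x) ^ m) ^ 2 := by rw [dip, mul_pow, ← pow_mul, mul_comm m]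
    _ ≤ 1 := (sq_le_one_iff_abs_le_one _).2 h1

lemma dip_mem_laurentPoly {w : Torus n → ℝ} {a : ℕ} (R : ℝ) (m : ℕ)
    (hw : (fun z => (w z : ℂ)) ∈ laurentPoly n a) :
    (fun z => (dip R m (w z) : ℂ)) ∈ laurentPoly n (a * (2 + 2 * m)) := by
  have h1 := sub_mem (const_mem_laurentPoly 1 a) hw
  have h2 := sub_mem (const_mem_laurentPoly 1 a) ((laurentPoly n a).smul_mem (R : ℂ)⁻¹ hw)
  rw [Nat.mul_add]
  convert mul_mem_laurentPoly (pow_mem_laurentPoly h1 2) (pow_mem_laurentPoly h2 (2 * m)) using 1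
  ext z
  simp [dip, div_eq_inv_mul]

/-- The sum `w` of `|u_ξ|²` over `P` is `1` on `P` and `0` on the rest of `Ξ`, so `dip ∘ w` has the
right values; but `w = 1` may also hold elsewhere. Averaging with `dip ∘ v`, where each term of `v`
is damped by `peak ξ`, removes the spurious zeros: `w = v = 1` forces `peak ξ z = 1` for some `ξ ∈
P` with `u ξ z ≠ 0`. -/
lemma exists_onesided_certificate {Ξ P : Finset (Torus n)} (hP : P ⊆ Ξ)
    {u : Torus n → Torus n → ℂ} (hu : IsInterpolationFamily Ξ u) {B : ℝ}
    (hB : ∀ ξ ∈ Ξ, ∀ z, ‖u ξ z‖ ^ 2 ≤ B) {m : ℕ} (hB0 : 0 ≤ B) (hm : Ξ.card * B + 1 ≤ m) :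
    ∃ s : Torus n → ℝ,
      (fun z => (s z : ℂ)) ∈ laurentPoly n ((2 * (Ξ.card - 1) + 1) * (2 + 2 * m)) ∧
      (∀ z, 0 ≤ s z) ∧ (∀ z, s z ≤ 1) ∧ (∀ ξ ∈ P, s ξ = 0) ∧ (∀ ξ ∈ Ξ, ξ ∉ P → s ξ = 1) ∧
      ∀ z, s z = 0 → z ∈ P := by
  classical
  set R : ℝ := Ξ.card * B + 1
  set w : Torus n → ℝ := fun z => ∑ ξ ∈ P, ‖u ξ z‖ ^ 2 with hw
  set v : Torus n → ℝ := fun z => ∑ ξ ∈ P, ‖u ξ z‖ ^ 2 * peak ξ z with hv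
  have hterm : ∀ z, ∀ ξ ∈ P, ‖u ξ z‖ ^ 2 * peak ξ z ≤ ‖u ξ z‖ ^ 2 := fun z ξ _ =>
    mul_le_of_le_one_right (by positivity) (peak_le_one _ _)
  have hvw : ∀ z, v z ≤ w z := fun z => Finset.sum_le_sum (hterm z)
  have hv0 : ∀ z, 0 ≤ v z := fun z =>
    Finset.sum_nonneg fun ξ _ => mul_nonneg (by positivity) (peak_nonneg _ _)
  have hwR : ∀ z, w z < R := fun z => by
    have h1 : w z ≤ P.card • B := Finset.sum_le_card_nsmul _ _ _ fun ξ hξ => hB ξ (hP hξ) z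
    have h2 : (P.card : ℝ) * B ≤ Ξ.card * B := by gcongr
    rw [nsmul_eq_mul] at h1
    linarith
  have hvR : ∀ z, v z < R := fun z => (hvw z).trans_lt (hwR z)
  have hw0 : ∀ z, 0 ≤ w z := fun z => (hv0 z).trans (hvw z)
  have hval : ∀ ξ ∈ P, ∀ η ∈ Ξ, u ξ η = if η = ξ then 1 else 0 := fun ξ hξ η hη => by
    split_ifs with h
    · rw [h]; exact (hu ξ (hP hξ)).2.1
    · exact (hu ξ (hP hξ)).2.2 η hη h
  have hwP : ∀ ξ ∈ P, w ξ = 1 := fun ξ hξ => by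
    rw [hw]
    simp only
    rw [Finset.sum_eq_single_of_mem ξ hξ fun η hη hne => by
      rw [hval η hη ξ (hP hξ), if_neg hne.symm]; simp]
    simp [hval ξ hξ ξ (hP hξ)]
  have hvP : ∀ ξ ∈ P, v ξ = 1 := fun ξ hξ => by
    rw [hv]
    simp only
    rw [Finset.sum_eq_single_of_mem ξ hξ fun η hη hne => by
      rw [hval η hη ξ (hP hξ), if_neg hne.symm]; simp]
    simp [hval ξ hξ ξ (hP hξ), peak_self]
  have hwN : ∀ ξ ∈ Ξ, ξ ∉ P → w ξ = 0 := fun ξ hξ hξP => Finset.sum_eq_zero fun η hη => by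
    rw [hval η hη ξ hξ, if_neg (by rintro rfl; exact hξP hη)]; simp
  have hvN : ∀ ξ ∈ Ξ, ξ ∉ P → v ξ = 0 := fun ξ hξ hξP =>
    le_antisymm ((hvw ξ).trans (hwN ξ hξ hξP).le) (hv0 ξ)
  refine ⟨fun z => (dip R m (w z) + dip R m (v z)) / 2, ?_, ?_, ?_, ?_, ?_, ?_⟩
  -- The degree of `w` is overstated by one to agree with that of `v`, which carries the factor
  -- `peak`.
  · have hwm : (fun z => (w z : ℂ)) ∈ laurentPoly n (2 * (Ξ.card - 1) + 1) := by
      convert sum_mem fun ξ (hξ : ξ ∈ P) => laurentPoly_mono (Nat.le_succ _)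
        (normSq_mem_laurentPoly (hu ξ (hP hξ)).1) using 1
      ext z
      simp [hw]
    have hvm : (fun z => (v z : ℂ)) ∈ laurentPoly n (2 * (Ξ.card - 1) + 1) := by
      convert sum_mem fun ξ (hξ : ξ ∈ P) => mul_mem_laurentPoly
        (normSq_mem_laurentPoly (hu ξ (hP hξ)).1) (peak_mem_laurentPoly ξ) using 1
      ext z
      simp [hv]
    convert (laurentPoly n _).smul_mem (1 / 2)
      (add_mem (dip_mem_laurentPoly R m hwm) (dip_mem_laurentPoly R m hvm)) using 1
    ext z
    simp
    ring
  · intro z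
    have := dip_nonneg R m (w z)
    have := dip_nonneg R m (v z)
    positivity
  · intro z
    have := dip_le_one hm (hw0 z) (hwR z)
    have := dip_le_one hm (hv0 z) (hvR z)
    dsimp only
    linarith
  · intro ξ hξ
    simp [hwP ξ hξ, hvP ξ hξ, dip_one]
  · intro ξ hξ hξP
    simp [hwN ξ hξ hξP, hvN ξ hξ hξP, dip_zero]
  · intro z hz
    have h1 := dip_nonneg R m (w z)
    have h2 := dip_nonneg R m (v z)
    have hw1 : w z = 1 := eq_one_of_dip_eq_zero (hw0 z) (hwR z) (m := m) (by linarith)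
    have hv1 : v z = 1 := eq_one_of_dip_eq_zero (hv0 z) (hvR z) (m := m) (by linarith)
    have heq : ∀ ξ ∈ P, ‖u ξ z‖ ^ 2 * peak ξ z = ‖u ξ z‖ ^ 2 :=
      (Finset.sum_eq_sum_iff_of_le (hterm z)).1 (hv1.trans hw1.symm)
    obtain ⟨ξ, hξ, hne⟩ := Finset.exists_ne_zero_of_sum_ne_zero (hw1.trans_ne one_ne_zero)
    rw [eq_of_peak_eq_one ((mul_eq_left₀ hne).1 (heq ξ hξ))]
    exact hξ

/-- A dual certificate for the sign pattern that is `+1` on `P` and `-1` on `Ξ \ P`: a real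
trigonometric polynomial of degree at most `D` with values in `[-1, 1]`, equal to `1` exactly on
`P` and to `-1` exactly on `Ξ \ P`. -/
structure IsCertificate (Ξ P : Finset (Torus n)) (D : ℕ) (q : Torus n → ℝ) : Prop where
  mem : (fun z => (q z : ℂ)) ∈ laurentPoly n D
  le_one : ∀ z, q z ≤ 1
  neg_one_le : ∀ z, -1 ≤ q z
  eq_one : ∀ ξ ∈ P, q ξ = 1
  eq_neg_one : ∀ ξ ∈ Ξ, ξ ∉ P → q ξ = -1
  mem_of_eq_one : ∀ z, q z = 1 → z ∈ P
  mem_of_eq_neg_one : ∀ z, q z = -1 → z ∈ Ξ ∧ z ∉ P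

/-- A difference of two functions with values in `[0, 1]` equals `±1` only if one of them is `0` and
the other `1`; the zero sets of the one-sided certificates for `P` and `Ξ \ P` thus control both
extremal sets. -/
lemma exists_certificate {Ξ P : Finset (Torus n)} (hP : P ⊆ Ξ)
    {u : Torus n → Torus n → ℂ} (hu : IsInterpolationFamily Ξ u) {B : ℝ}
    (hB : ∀ ξ ∈ Ξ, ∀ z, ‖u ξ z‖ ^ 2 ≤ B) {m : ℕ} (hB0 : 0 ≤ B) (hm : Ξ.card * B + 1 ≤ m) :
    ∃ q, IsCertificate Ξ P ((2 * (Ξ.card - 1) + 1) * (2 + 2 * m)) q := by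
  classical
  obtain ⟨s, hs, hs0, hs1, hsP, hsN, hsz⟩ := exists_onesided_certificate hP hu hB hB0 hm
  obtain ⟨t, ht, ht0, ht1, htP, htN, htz⟩ :=
    exists_onesided_certificate (P := Ξ \ P) Finset.sdiff_subset hu hB hB0 hm
  refine ⟨fun z => t z - s z, ?_, ?_, ?_, ?_, ?_, ?_, ?_⟩
  · convert sub_mem ht hs using 1
    ext z; simp
  · intro z; linarith [ht1 z, hs0 z]
  · intro z; linarith [ht0 z, hs1 z]
  · intro ξ hξ
    simp [hsP ξ hξ, htN ξ (hP hξ) (by simp [hξ])]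
  · intro ξ hξ hξP
    simp [hsN ξ hξ hξP, htP ξ (by simp [hξ, hξP])]
  · intro z hz
    exact hsz z (by linarith [ht1 z, hs0 z])
  · intro z hz
    simpa using htz z (by linarith [ht0 z, hs1 z])

lemma isCertificate_zero (D : ℕ) : IsCertificate (n := n) ∅ ∅ D 0 where
  mem := by simpa using const_mem_laurentPoly 0 D
  le_one := by simp
  neg_one_le := by simp
  eq_one := by simp
  eq_neg_one := by simp
  mem_of_eq_one := by simp
  mem_of_eq_neg_one := by simp

/-! ### Interpolation families, entropy and the degree bound. -/

lemma prod_mem_laurentPoly {ι : Type*} (s : Finset ι) {f : ι → Torus n → ℂ}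
    (hf : ∀ i ∈ s, f i ∈ laurentPoly n 1) : ∏ i ∈ s, f i ∈ laurentPoly n s.card := by
  classical
  induction s using Finset.induction_on with
  | empty => exact const_mem_laurentPoly 1 0
  | insert a s ha ih =>
    rw [Finset.prod_insert ha, Finset.card_insert_of_notMem ha, add_comm]
    exact mul_mem_laurentPoly (hf a (by simp)) (ih fun i hi => hf i (by simp [hi]))

lemma exists_separating_laurentPoly {ξ η : Torus n} (h : ξ ≠ η) :
    ∃ f ∈ laurentPoly n 1, f ξ = 1 ∧ f η = 0 := by
  obtain ⟨k, hk⟩ := Function.ne_iff.1 h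
  have hk' : (ξ k : ℂ) - η k ≠ 0 := sub_ne_zero.2 fun h => hk (Circle.ext h)
  refine ⟨fun z => ((ξ k : ℂ) - η k)⁻¹ * (z k - η k), ?_, ?_, ?_⟩
  · convert (laurentPoly n 1).smul_mem ((ξ k : ℂ) - η k)⁻¹
      (sub_mem (mono_mem_laurentPoly (α := Pi.single k 1) (by simp [l1_single]))
        (const_mem_laurentPoly (η k : ℂ) 1)) using 1
    ext z
    simp [mono_single]
  · simp [hk']
  · simp

/-- Lagrange interpolation: one degree-one factor for each other node, hence total degree at most
`|Ξ| - 1`. -/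
lemma exists_isInterpolationFamily (Ξ : Finset (Torus n)) :
    ∃ u, IsInterpolationFamily Ξ u := by
  classical
  choose! f hf using fun ξ η : Torus n => exists_separating_laurentPoly (ξ := ξ) (η := η)
  refine ⟨fun ξ => ∏ η ∈ Ξ.erase ξ, f ξ η, fun ξ hξ => ⟨?_, ?_, fun η hη hne => ?_⟩⟩
  · rw [← Finset.card_erase_of_mem hξ]
    exact prod_mem_laurentPoly _ fun η hη => (hf ξ η (Finset.ne_of_mem_erase hη).symm).1
  · simp only [Finset.prod_apply]
    exact Finset.prod_eq_one fun η hη => (hf ξ η (Finset.ne_of_mem_erase hη).symm).2.1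
  · simp only [Finset.prod_apply]
    exact Finset.prod_eq_zero (Finset.mem_erase.2 ⟨hne, hη⟩) (hf ξ η hne.symm).2.2

lemma exists_bound_of_isInterpolationFamily {Ξ : Finset (Torus n)} {u : Torus n → Torus n → ℂ}
    (hu : IsInterpolationFamily Ξ u) : ∃ M, 0 ≤ M ∧ ∀ ξ ∈ Ξ, ∀ z, ‖u ξ z‖ ^ 2 ≤ M := by
  have h : ∀ ξ ∈ Ξ, ∃ M, ∀ z, ‖u ξ z‖ ^ 2 ≤ M := fun ξ hξ => by
    have hc : Continuous fun z => ‖u ξ z‖ ^ 2 :=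
      (continuous_of_mem_laurentPoly (hu ξ hξ).1).norm.pow 2
    obtain ⟨M, hM⟩ := (isCompact_range hc).bddAbove
    exact ⟨M, fun z => hM ⟨z, rfl⟩⟩
  choose! M hM using h
  refine ⟨∑ ξ ∈ Ξ, M ξ, Finset.sum_nonneg fun ξ hξ => (sq_nonneg _).trans (hM ξ hξ 1),
    fun ξ hξ z => (hM ξ hξ z).trans ?_⟩
  exact Finset.single_le_sum (fun η hη => (sq_nonneg _).trans (hM η hη 1)) hξ

lemma exists_isInterpolationFamily_lt {Ξ : Finset (Torus n)} {c : ℝ} (hc : entropy Ξ < c) :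
    ∃ u, IsInterpolationFamily Ξ u ∧ ∀ ξ ∈ Ξ, ∀ z, ‖u ξ z‖ ^ 2 ≤ c := by
  obtain ⟨u, hu⟩ := exists_isInterpolationFamily Ξ
  obtain ⟨M, hM0, hM⟩ := exists_bound_of_isInterpolationFamily hu
  obtain ⟨b, ⟨-, v, hv, hvb⟩, hbc⟩ := exists_lt_of_csInf_lt (by exact ⟨M, hM0, u, hu, hM⟩) hc
  exact ⟨v, hv, fun ξ hξ z => (hvb ξ hξ z).trans hbc.le⟩

lemma one_le_entropy {Ξ : Finset (Torus n)} (hΞ : Ξ.Nonempty) : 1 ≤ entropy Ξ := by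
  obtain ⟨u, hu⟩ := exists_isInterpolationFamily Ξ
  obtain ⟨M, hM0, hM⟩ := exists_bound_of_isInterpolationFamily hu
  refine le_csInf ⟨M, hM0, u, hu, hM⟩ ?_
  rintro b ⟨-, v, hv, hvb⟩
  obtain ⟨ξ, hξ⟩ := hΞ
  simpa [(hv ξ hξ).2.1] using hvb ξ hξ ξ

lemma exists_certificate_of_entropy_le {Ξ P : Finset (Torus n)} (hP : P ⊆ Ξ) {D : ℕ}
    (hD : (8 * (Ξ.card : ℝ) ^ 2 + 12 * Ξ.card + 1) * entropy Ξ ≤ D) :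
    (∃ q, IsCertificate Ξ P D q) ∧
      ∃ u, IsInterpolationFamily Ξ u ∧ ∀ ξ ∈ Ξ, u ξ ∈ laurentPoly n D := by
  rcases Ξ.eq_empty_or_nonempty with rfl | hΞ
  · rw [Finset.subset_empty.1 hP]
    exact ⟨⟨0, isCertificate_zero D⟩, 0, fun ξ hξ => by simp at hξ, fun ξ hξ => by simp at hξ⟩
  have hE := one_le_entropy hΞ
  have hr : 1 ≤ Ξ.card := hΞ.card_pos
  -- Doubling gives strict slack, so attainment of the infimum is not needed; it is legitimate
  -- because the entropy is at least `1`.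
  obtain ⟨u, hu, huB⟩ := exists_isInterpolationFamily_lt (c := 2 * entropy Ξ) (by linarith)
  have hR0 : 0 ≤ Ξ.card * (2 * entropy Ξ) + 1 := by positivity
  obtain ⟨q, hq⟩ := exists_certificate hP hu huB (by linarith) (Nat.le_ceil _)
  have hm := Nat.ceil_lt_add_one hR0
  set m := ⌈(Ξ.card * (2 * entropy Ξ) + 1 : ℝ)⌉₊
  have hdeg : (2 * (Ξ.card - 1) + 1) * (2 + 2 * m) ≤ D := by
    have h1 : 2 * (Ξ.card - 1) + 1 ≤ 2 * Ξ.card := by omega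
    refine (Nat.mul_le_mul_right _ h1).trans ?_
    rify
    have hr' : (1 : ℝ) ≤ Ξ.card := by exact_mod_cast hr
    calc 2 * (Ξ.card : ℝ) * (2 + 2 * m)
        ≤ 2 * (Ξ.card : ℝ) * (2 + 2 * (Ξ.card * (2 * entropy Ξ) + 1 + 1)) := by gcongr
      _ = 8 * (Ξ.card : ℝ) ^ 2 * entropy Ξ + 12 * Ξ.card * 1 := by ring
      -- The term free of entropy is absorbed using `1 ≤ entropy Ξ`.
      _ ≤ 8 * (Ξ.card : ℝ) ^ 2 * entropy Ξ + 12 * Ξ.card * entropy Ξ := by gcongr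
      _ ≤ _ := by linarith
  refine ⟨⟨q, { hq with mem := laurentPoly_mono hdeg hq.mem }⟩, u, hu, fun ξ hξ =>
    laurentPoly_mono (le_trans ?_ hdeg) (hu ξ hξ).1⟩
  nlinarith [Nat.zero_le m, Nat.zero_le (Ξ.card - 1)]

/-! ### Positive functionals, duality and rigidity. -/

/-- The Laurent polynomial with given coefficients, as a function on the torus. -/
noncomputable abbrev laurentEval : ((Fin n → ℤ) →₀ ℂ) →ₗ[ℂ] (Torus n → ℂ) :=
  Finsupp.linearCombination ℂ mono

/-- The Riesz functional of the sequence `y`. -/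
noncomputable abbrev riesz (y : (Fin n → ℤ) → ℂ) : ((Fin n → ℤ) →₀ ℂ) →ₗ[ℂ] ℂ :=
  Finsupp.linearCombination ℂ y

/-- The Riesz functional of `y` is positive: it maps Laurent polynomials with nonnegative real part
on the torus to complex numbers with nonnegative real part. -/
def IsPositiveSeq (y : (Fin n → ℤ) → ℂ) : Prop :=
  ∀ p, (∀ z, 0 ≤ (laurentEval p z).re) → 0 ≤ (riesz y p).re

lemma laurentEval_single (γ : Fin n → ℤ) (c : ℂ) :
    laurentEval (Finsupp.single γ c) = c • mono γ := by simp [laurentEval]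

lemma riesz_single (y : (Fin n → ℤ) → ℂ) (γ : Fin n → ℤ) (c : ℂ) :
    riesz y (Finsupp.single γ c) = c * y γ := by simp [riesz]

lemma continuous_laurentEval (p : (Fin n → ℤ) →₀ ℂ) : Continuous (laurentEval p) := by
  induction p using Finsupp.induction_linear with
  | zero => simpa using! continuous_const
  | add p q hp hq => rw [laurentEval, map_add]; exact hp.add hq
  | single γ c => rw [laurentEval_single]; exact (continuous_mono γ).const_smul c

lemma exists_laurentEval_eq {f : Torus n → ℂ} {D : ℕ} (hf : f ∈ laurentPoly n D) :
    ∃ p : (Fin n → ℤ) →₀ ℂ, laurentEval p = f ∧ ∀ γ ∈ p.support, l1 γ ≤ D := by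
  have : f ∈ Submodule.span ℂ (mono '' {α : Fin n → ℤ | l1 α ≤ D}) := by
    refine Submodule.span_mono ?_ hf
    rintro _ ⟨α, h, rfl⟩
    exact ⟨α, h, rfl⟩
  obtain ⟨p, hp, rfl⟩ := (Finsupp.mem_span_image_iff_linearCombination ℂ).1 this
  exact ⟨p, rfl, fun γ hγ => hp hγ⟩

lemma riesz_eq_of_eqOn {y y' : (Fin n → ℤ) → ℂ} {p : (Fin n → ℤ) →₀ ℂ}
    (h : ∀ γ ∈ p.support, y γ = y' γ) : riesz y p = riesz y' p := by
  simp only [riesz, Finsupp.linearCombination_apply]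
  exact Finsupp.sum_congr fun γ hγ => by rw [h γ hγ]

lemma riesz_sub (y y' : (Fin n → ℤ) → ℂ) (p : (Fin n → ℤ) →₀ ℂ) :
    riesz (fun γ => y γ - y' γ) p = riesz y p - riesz y' p := by
  simp only [riesz, Finsupp.linearCombination_apply, smul_sub, Finsupp.sum_sub]

/-- The moment sequence of the atomic measure with weights `c` on `Ξ`. -/
noncomputable def atomicMoment (Ξ : Finset (Torus n)) (c : Torus n → ℝ) (γ : Fin n → ℤ) : ℂ :=
  ∑ ξ ∈ Ξ, (c ξ : ℂ) * mono γ ξ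

lemma riesz_atomicMoment (Ξ : Finset (Torus n)) (c : Torus n → ℝ) (p : (Fin n → ℤ) →₀ ℂ) :
    riesz (atomicMoment Ξ c) p = ∑ ξ ∈ Ξ, (c ξ : ℂ) * laurentEval p ξ := by
  induction p using Finsupp.induction_linear with
  | zero => simp
  | add p q hp hq => simp only [map_add, hp, hq, Pi.add_apply, mul_add, Finset.sum_add_distrib]
  | single γ a =>
    rw [riesz_single, laurentEval_single, atomicMoment, Finset.mul_sum]
    exact Finset.sum_congr rfl fun ξ _ => by simp; ring

/-- On the compact set where `|f| ≥ ε`, `h` has no zero, so `|f| / h` is bounded there. -/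
lemma exists_norm_le_add_mul {f : Torus n → ℂ} {h : Torus n → ℝ} (hf : Continuous f)
    (hh : Continuous h) (h0 : ∀ z, 0 ≤ h z) (hfh : ∀ z, h z = 0 → f z = 0) {ε : ℝ} (hε : 0 < ε) :
    ∃ K : ℝ, ∀ z, ‖f z‖ ≤ ε + K * h z := by
  have hK : IsCompact {z | ε ≤ ‖f z‖} := (isClosed_le continuous_const hf.norm).isCompact
  have hne : ∀ z ∈ {z | ε ≤ ‖f z‖}, h z ≠ 0 := fun z hz h1 => by
    have : ε ≤ ‖f z‖ := hz
    rw [hfh z h1, norm_zero] at this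
    linarith
  obtain ⟨K, hKb⟩ := (hK.image_of_continuousOn
    (f := fun z => ‖f z‖ / h z) (hf.norm.continuousOn.div hh.continuousOn hne)).bddAbove
  refine ⟨max K 0, fun z => ?_⟩
  rcases lt_or_ge ‖f z‖ ε with hz | hz
  · have : 0 ≤ max K 0 * h z := mul_nonneg (le_max_right _ _) (h0 z)
    linarith
  · have h1 : ‖f z‖ / h z ≤ K := hKb ⟨z, hz, rfl⟩
    rw [div_le_iff₀ ((h0 z).lt_of_ne' (hne z hz))] at h1
    have : K * h z ≤ max K 0 * h z := mul_le_mul_of_nonneg_right (le_max_left _ _) (h0 z)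
    linarith

/-- The functional is positive on `ε + K p - f` and its real part vanishes on `p`, which leaves `Re
L(f) ≤ ε Re y₀` with `ε` arbitrary. This replaces the support of a representing measure. -/
lemma IsPositiveSeq.re_riesz_nonpos {y : (Fin n → ℤ) → ℂ} (hy : IsPositiveSeq y)
    {p f : (Fin n → ℤ) →₀ ℂ} (hp : ∀ z, 0 ≤ (laurentEval p z).re) (hp0 : (riesz y p).re = 0)
    (hf : ∀ z, (laurentEval p z).re = 0 → laurentEval f z = 0) : (riesz y f).re ≤ 0 := by
  refine le_of_forall_pos_le_add fun δ hδ => ?_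
  have hε : 0 < δ / (|(y 0).re| + 1) := by positivity
  obtain ⟨K, hK⟩ := exists_norm_le_add_mul (continuous_laurentEval f)
    (Complex.continuous_re.comp (continuous_laurentEval p)) hp hf hε
  set ε := δ / (|(y 0).re| + 1) with hεdef
  have h := hy (Finsupp.single 0 (ε : ℂ) + (K : ℂ) • p - f) fun z => by
    simp only [map_add, map_sub, map_smul, Pi.add_apply, Pi.sub_apply, Pi.smul_apply,
      laurentEval_single, mono_zero]
    have := (Complex.re_le_norm _).trans (hK z)
    simp only [Function.comp] at this
    simpa using this
  simp only [map_add, map_sub, map_smul, riesz_single] at h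
  simp only [smul_eq_mul, Complex.sub_re, Complex.add_re, Complex.re_ofReal_mul, hp0] at h
  have h2 : ε * (y 0).re ≤ δ := by
    calc ε * (y 0).re ≤ ε * (|(y 0).re| + 1) := by
          gcongr
          linarith [le_abs_self (y 0).re]
      _ = δ := by rw [hεdef]; field_simp
  linarith

lemma IsPositiveSeq.riesz_eq_zero {y : (Fin n → ℤ) → ℂ} (hy : IsPositiveSeq y)
    {p f : (Fin n → ℤ) →₀ ℂ} (hp : ∀ z, 0 ≤ (laurentEval p z).re) (hp0 : (riesz y p).re = 0)
    (hf : ∀ z, (laurentEval p z).re = 0 → laurentEval f z = 0) : riesz y f = 0 := by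
  have key : ∀ c : ℂ, (c * riesz y f).re ≤ 0 := fun c => by
    have := hy.re_riesz_nonpos (f := c • f) hp hp0 fun z hz => by
      rw [map_smul, Pi.smul_apply, hf z hz, smul_zero]
    rwa [map_smul] at this
  have h1 := key 1
  have h2 := key (-1)
  have h3 := key Complex.I
  have h4 := key (-Complex.I)
  simp at h1 h2 h3 h4
  exact Complex.ext (le_antisymm h1 h2) (le_antisymm h4 h3)

section Rigidity

variable {Ξ P : Finset (Torus n)} {D : ℕ} {q : Torus n → ℝ} {c : Torus n → ℝ}
  {yp ym : (Fin n → ℤ) → ℂ}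

/-- Since `q` has degree at most `D`, the known moments suffice to pair with it, and `q` carries the
sign of the weight at each node. -/
lemma IsCertificate.exists_riesz_eq (hq : IsCertificate Ξ P D q)
    (hpos : ∀ ξ ∈ P, 0 ≤ c ξ) (hneg : ∀ ξ ∈ Ξ, ξ ∉ P → c ξ ≤ 0)
    (hM : ∀ γ, l1 γ ≤ D → yp γ - ym γ = atomicMoment Ξ c γ) :
    ∃ p : (Fin n → ℤ) →₀ ℂ, (∀ z, laurentEval p z = q z) ∧
      riesz yp p - riesz ym p = ((∑ ξ ∈ Ξ, |c ξ| : ℝ) : ℂ) := by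
  obtain ⟨p, hp, hpD⟩ := exists_laurentEval_eq hq.mem
  refine ⟨p, fun z => congrFun hp z, ?_⟩
  rw [← riesz_sub, riesz_eq_of_eqOn fun γ hγ => hM γ (hpD γ hγ), riesz_atomicMoment]
  push_cast
  refine Finset.sum_congr rfl fun ξ hξ => ?_
  rw [hp]
  by_cases hξP : ξ ∈ P
  · simp [hq.eq_one ξ hξP, abs_of_nonneg (hpos ξ hξP)]
  · simp [hq.eq_neg_one ξ hξ hξP, abs_of_nonpos (hneg ξ hξ hξP)]

/-- Weak duality: add the positivity of `yp` on `1 - q` to that of `ym` on `1 + q`. -/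
lemma IsCertificate.sum_abs_le (hq : IsCertificate Ξ P D q)
    (hpos : ∀ ξ ∈ P, 0 ≤ c ξ) (hneg : ∀ ξ ∈ Ξ, ξ ∉ P → c ξ ≤ 0)
    (hyp : IsPositiveSeq yp) (hym : IsPositiveSeq ym)
    (hM : ∀ γ, l1 γ ≤ D → yp γ - ym γ = atomicMoment Ξ c γ) :
    ∑ ξ ∈ Ξ, |c ξ| ≤ (yp 0 + ym 0).re := by
  obtain ⟨p, hp, hpc⟩ := hq.exists_riesz_eq hpos hneg hM
  have h1 := hyp (Finsupp.single 0 1 - p) fun z => by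
    simpa [laurentEval_single, mono_zero, hp] using hq.le_one z
  have h2 := hym (Finsupp.single 0 1 + p) fun z => by
    have := hq.neg_one_le z
    simp [mono_zero, hp]
    linarith
  have h3 := congrArg Complex.re hpc
  simp only [map_sub, map_add, riesz_single, Complex.sub_re, Complex.add_re, one_mul,
    Complex.ofReal_re] at h1 h2 h3 ⊢
  linarith

/-- Complementary slackness: equality in weak duality makes both positivity inequalities tight, so
each functional annihilates every Laurent polynomial vanishing on `Ξ`, whatever its degree. -/
lemma IsCertificate.eq_atomicMoment (hq : IsCertificate Ξ P D q) (hP : P ⊆ Ξ)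
    (hpos : ∀ ξ ∈ P, 0 ≤ c ξ) (hneg : ∀ ξ ∈ Ξ, ξ ∉ P → c ξ ≤ 0)
    {u : Torus n → Torus n → ℂ} (hu : IsInterpolationFamily Ξ u)
    (huD : ∀ ξ ∈ Ξ, u ξ ∈ laurentPoly n D)
    (hyp : IsPositiveSeq yp) (hym : IsPositiveSeq ym)
    (hM : ∀ γ, l1 γ ≤ D → yp γ - ym γ = atomicMoment Ξ c γ)
    (hle : (yp 0 + ym 0).re ≤ ∑ ξ ∈ Ξ, |c ξ|) (γ : Fin n → ℤ) :
    yp γ - ym γ = atomicMoment Ξ c γ := by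
  obtain ⟨p, hp, hpc⟩ := hq.exists_riesz_eq hpos hneg hM
  have e1 : ∀ z, (laurentEval (Finsupp.single 0 1 - p) z).re = 1 - q z := fun z => by
    simp [mono_zero, hp]
  have e2 : ∀ z, (laurentEval (Finsupp.single 0 1 + p) z).re = 1 + q z := fun z => by
    simp [mono_zero, hp]
  have n1 : ∀ z, 0 ≤ (laurentEval (Finsupp.single 0 1 - p) z).re := fun z => by
    rw [e1]; linarith [hq.le_one z]
  have n2 : ∀ z, 0 ≤ (laurentEval (Finsupp.single 0 1 + p) z).re := fun z => by
    rw [e2]; linarith [hq.neg_one_le z]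
  have h1 := hyp _ n1
  have h2 := hym _ n2
  have h3 := congrArg Complex.re hpc
  have s1 : (riesz yp (Finsupp.single 0 1 - p)).re = (yp 0).re - (riesz yp p).re := by
    simp only [map_sub, riesz_single, one_mul, Complex.sub_re]
  have s2 : (riesz ym (Finsupp.single 0 1 + p)).re = (ym 0).re + (riesz ym p).re := by
    simp only [map_add, riesz_single, one_mul, Complex.add_re]
  simp only [Complex.sub_re, Complex.add_re, Complex.ofReal_re] at h3 hle
  have z1 : (riesz yp (Finsupp.single 0 1 - p)).re = 0 := by linarith
  have z2 : (riesz ym (Finsupp.single 0 1 + p)).re = 0 := by linarith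
  choose! v hv hvD using fun ξ (hξ : ξ ∈ Ξ) => exists_laurentEval_eq (huD ξ hξ)
  -- The interpolation remainder of `z^γ`: killing it reduces the moment at `γ` to those of the
  -- `u_ξ`, which have degree at most `D`.
  set f : (Fin n → ℤ) →₀ ℂ := Finsupp.single γ 1 - ∑ ξ ∈ Ξ, mono γ ξ • v ξ with hf
  have hf0 : ∀ η ∈ Ξ, laurentEval f η = 0 := fun η hη => by
    rw [hf, map_sub, laurentEval_single, map_sum, Pi.sub_apply, Finset.sum_apply,
      Finset.sum_eq_single_of_mem η hη fun ξ hξ hne => by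
        rw [map_smul, Pi.smul_apply, hv ξ hξ, (hu ξ hξ).2.2 η hη hne.symm, smul_zero]]
    rw [map_smul, Pi.smul_apply, Pi.smul_apply, hv η hη, (hu η hη).2.1]
    simp
  have r1 : riesz yp f = 0 := hyp.riesz_eq_zero n1 z1 fun z hz =>
    hf0 z (hP (hq.mem_of_eq_one z (by rw [e1] at hz; linarith)))
  have r2 : riesz ym f = 0 := hym.riesz_eq_zero n2 z2 fun z hz =>
    hf0 z (hq.mem_of_eq_neg_one z (by rw [e2] at hz; linarith)).1
  have r3 : riesz (atomicMoment Ξ c) f = 0 := by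
    rw [riesz_atomicMoment]
    exact Finset.sum_eq_zero fun ξ hξ => by rw [hf0 ξ hξ, mul_zero]
  have r4 : ∀ ξ ∈ Ξ, riesz yp (v ξ) - riesz ym (v ξ) = riesz (atomicMoment Ξ c) (v ξ) :=
    fun ξ hξ => by rw [← riesz_sub, riesz_eq_of_eqOn fun γ hγ => hM γ (hvD ξ hξ γ hγ)]
  rw [hf, map_sub, map_sum, riesz_single, one_mul, sub_eq_zero] at r1 r2 r3
  rw [r1, r2, r3, ← Finset.sum_sub_distrib]
  refine Finset.sum_congr rfl fun ξ hξ => ?_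
  rw [map_smul, map_smul, map_smul, ← smul_sub, r4 ξ hξ]

end Rigidity

/-! ### From positive semidefinite Toeplitz matrices to positive functionals. -/

/-- The standard parametrization of the torus. -/
noncomputable def ofUnitAddTorus (x : UnitAddTorus (Fin n)) : Torus n := fun i => (x i).toCircle

lemma mono_ofUnitAddTorus (γ : Fin n → ℤ) (x : UnitAddTorus (Fin n)) :
    mono γ (ofUnitAddTorus x) = UnitAddTorus.mFourier γ x := by
  simp only [mono, ofUnitAddTorus, UnitAddTorus.mFourier, ContinuousMap.coe_mk, fourier_apply,
    AddCircle.toCircle_zsmul, Circle.coe_zpow]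

/-- The Haar probability measure of the additive torus. -/
noncomputable def torusHaar (n : ℕ) : Measure (UnitAddTorus (Fin n)) :=
  Measure.pi fun _ => AddCircle.haarAddCircle

instance : IsProbabilityMeasure (torusHaar n) :=
  inferInstanceAs (IsProbabilityMeasure (Measure.pi fun _ => AddCircle.haarAddCircle))

lemma integral_mono (γ : Fin n → ℤ) :
    ∫ x, mono γ (ofUnitAddTorus x) ∂torusHaar n = if γ = 0 then 1 else 0 := by
  have h := orthonormal_iff_ite.1 (UnitAddTorus.orthonormal_mFourier (d := Fin n)) 0 γ
  simp only [ContinuousMap.inner_toLp, ← UnitAddTorus.mFourier_neg,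
    ← UnitAddTorus.mFourier_add] at h
  simp_rw [mono_ofUnitAddTorus]
  rw [neg_zero, add_zero] at h
  simp only [eq_comm (a := γ)]
  exact h

lemma integrable_mono (γ : Fin n → ℤ) :
    Integrable (fun x => mono γ (ofUnitAddTorus x)) (torusHaar n) := by
  simp_rw [mono_ofUnitAddTorus]
  exact (UnitAddTorus.mFourier γ).continuous.integrable_of_hasCompactSupport
    (HasCompactSupport.of_compactSpace _)

lemma toeplitz_posSemidef_of_le {d k : ℕ} (h : k ≤ d) {y : (Fin n → ℤ) → ℂ}
    (hy : (toeplitz d y).PosSemidef) : (toeplitz k y).PosSemidef :=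
  hy.submatrix fun α : MultiIdx n k => (⟨α.1, α.2.trans h⟩ : MultiIdx n d)

/-- The difference of two multi-indices in the box `[0, N)ⁿ`. -/
def boxSub {N : ℕ} (α β : Fin n → Fin N) : Fin n → ℤ := fun i => (α i : ℤ) - (β i : ℤ)

/-- Boxes are used instead of simplices because their difference counts factor over the coordinates;
the box fits in the simplex of size `n * N`. -/
lemma boxToeplitz_posSemidef {y : (Fin n → ℤ) → ℂ} (hy : ∀ d, (toeplitz d y).PosSemidef) (N : ℕ) :
    (Matrix.of fun α β : Fin n → Fin N => y (boxSub β α)).PosSemidef :=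
  (hy (n * N)).submatrix fun α : Fin n → Fin N => (⟨fun i => α i, by
    calc ∑ i, (α i : ℕ) ≤ ∑ _i : Fin n, N := Finset.sum_le_sum fun i _ => (α i).2.le
      _ = n * N := by simp⟩ : MultiIdx n (n * N))

/-- This is the quadratic form of the box matrix at the vector `(z^{-β})_β`. -/
lemma fejer_nonneg {y : (Fin n → ℤ) → ℂ} (hy : ∀ d, (toeplitz d y).PosSemidef) (N : ℕ)
    (z : Torus n) :
    0 ≤ ∑ α : Fin n → Fin N, ∑ β : Fin n → Fin N, y (boxSub β α) * mono (boxSub α β) z := by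
  have h := (boxToeplitz_posSemidef hy N).dotProduct_mulVec_nonneg
    fun β => mono (fun i => -(β i : ℤ)) z
  refine h.trans_eq ?_
  simp only [dotProduct, Matrix.mulVec, Finset.mul_sum, Matrix.of_apply, Pi.star_apply]
  refine Finset.sum_congr rfl fun α _ => Finset.sum_congr rfl fun β _ => ?_
  have h1 : star (mono (fun i => -(α i : ℤ)) z) = mono (fun i => (α i : ℤ)) z := by
    rw [← Pi.star_apply, star_mono]
    congr 1
    ext i
    simp
  have h2 : boxSub α β = (fun i => (α i : ℤ)) + fun i => -(β i : ℤ) := by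
    ext i; simp [boxSub, sub_eq_add_neg]
  rw [h1, h2, mono_add, Pi.mul_apply]
  ring

/-- The number of pairs in the box `[0, N)ⁿ` whose difference is `γ`. -/
noncomputable def boxCount (N : ℕ) (γ : Fin n → ℤ) : ℝ :=
  ∑ α : Fin n → Fin N, ∑ β : Fin n → Fin N, if γ + boxSub α β = 0 then 1 else 0

/-- Integrate `p` against the nonnegative sum of `fejer_nonneg`: orthogonality keeps only the index
pairs with difference `γ`, giving a Fejér-weighted version of `riesz y p`. -/
lemma re_sum_boxCount_nonneg {y : (Fin n → ℤ) → ℂ} (hy : ∀ d, (toeplitz d y).PosSemidef)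
    {p : (Fin n → ℤ) →₀ ℂ} (hp : ∀ z, 0 ≤ (laurentEval p z).re) (N : ℕ) :
    0 ≤ (∑ γ ∈ p.support, p γ * y γ * boxCount N γ).re := by
  have hI : ∫ x, laurentEval p (ofUnitAddTorus x) * ∑ α : Fin n → Fin N, ∑ β : Fin n → Fin N,
        y (boxSub β α) * mono (boxSub α β) (ofUnitAddTorus x) ∂torusHaar n =
      ∑ γ ∈ p.support, p γ * y γ * boxCount N γ := by
    have h1 : ∀ x : UnitAddTorus (Fin n), laurentEval p (ofUnitAddTorus x) *
        ∑ α : Fin n → Fin N, ∑ β : Fin n → Fin N,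
          y (boxSub β α) * mono (boxSub α β) (ofUnitAddTorus x) =
        ∑ γ ∈ p.support, ∑ α : Fin n → Fin N, ∑ β : Fin n → Fin N,
          (p γ * y (boxSub β α)) * mono (γ + boxSub α β) (ofUnitAddTorus x) := fun x => by
      rw [laurentEval, Finsupp.linearCombination_apply, Finsupp.sum, Finset.sum_apply,
        Finset.sum_mul]
      refine Finset.sum_congr rfl fun γ _ => ?_
      simp only [Finset.mul_sum, Pi.smul_apply, smul_eq_mul, mono_add, Pi.mul_apply]
      exact Finset.sum_congr rfl fun α _ => Finset.sum_congr rfl fun β _ => by ring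
    simp_rw [h1]
    have hint : ∀ (c : ℂ) (γ : Fin n → ℤ), Integrable
        (fun x => c * mono γ (ofUnitAddTorus x)) (torusHaar n) := fun c γ => (integrable_mono γ).const_mul c
    rw [integral_finsetSum _ fun γ _ => integrable_finsetSum _ fun α _ =>
      integrable_finsetSum _ fun β _ => hint _ _]
    refine Finset.sum_congr rfl fun γ _ => ?_
    rw [integral_finsetSum _ fun α _ => integrable_finsetSum _ fun β _ => hint _ _, boxCount,
      Complex.ofReal_sum, Finset.mul_sum]
    refine Finset.sum_congr rfl fun α _ => ?_
    rw [integral_finsetSum _ fun β _ => hint _ _, Complex.ofReal_sum, Finset.mul_sum]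
    refine Finset.sum_congr rfl fun β _ => ?_
    rw [integral_const_mul, integral_mono]
    split_ifs with h
    · have : boxSub β α = γ := by
        rw [eq_neg_of_add_eq_zero_left h]
        ext i; simp [boxSub]
      simp [this]
    · simp
  rw [← hI]
  set F : UnitAddTorus (Fin n) → ℂ := fun x => laurentEval p (ofUnitAddTorus x) *
      ∑ α : Fin n → Fin N, ∑ β : Fin n → Fin N,
        y (boxSub β α) * mono (boxSub α β) (ofUnitAddTorus x) with hF
  change 0 ≤ (∫ x, F x ∂torusHaar n).re
  have hF0 : ∀ x, 0 ≤ (F x).re := fun x => by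
    have h2 := fejer_nonneg hy N (ofUnitAddTorus x)
    rw [Complex.nonneg_iff] at h2
    simp only [hF, Complex.mul_re, ← h2.2, mul_zero, sub_zero]
    exact mul_nonneg (hp _) h2.1
  by_cases hFi : Integrable F (torusHaar n)
  · have := integral_re hFi
    simp only [RCLike.re_eq_complex_re] at this
    rw [← this]
    exact integral_nonneg hF0
  · rw [integral_undef hFi]; simp

lemma boxCount_eq_prod (N : ℕ) (γ : Fin n → ℤ) :
    boxCount N γ = ∏ i, ∑ a : Fin N, ∑ b : Fin N,
      if γ i + ((a : ℤ) - (b : ℤ)) = 0 then (1 : ℝ) else 0 := by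
  simp only [Finset.prod_univ_sum, Fintype.piFinset_univ, boxCount]
  refine Finset.sum_congr rfl fun α _ => Finset.sum_congr rfl fun β _ => ?_
  rw [Finset.prod_ite_zero]
  simp [funext_iff, boxSub]

lemma sum_ite_add_sub_eq_zero (N : ℕ) (k : ℤ) (a : Fin N) :
    (∑ b : Fin N, if k + ((a : ℤ) - (b : ℤ)) = 0 then (1 : ℝ) else 0) =
      if 0 ≤ k + a ∧ k + a < N then 1 else 0 := by
  split_ifs with h
  · rw [Finset.sum_eq_single_of_mem ⟨(k + a).toNat, by omega⟩ (Finset.mem_univ _)]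
    · rw [if_pos]
      simp only
      omega
    · intro b _ hb
      rw [if_neg]
      rw [Ne, Fin.ext_iff] at hb
      simp only at hb
      omega
  · refine Finset.sum_eq_zero fun b _ => if_neg ?_
    have := b.2
    omega

lemma sub_natAbs_le_shiftCount (N : ℕ) (k : ℤ) :
    (N : ℝ) - k.natAbs ≤ ∑ a : Fin N, if 0 ≤ k + (a : ℤ) ∧ k + (a : ℤ) < N then (1 : ℝ) else 0 := by
  rw [Fin.sum_univ_eq_sum_range (fun a : ℕ => if 0 ≤ k + (a : ℤ) ∧ k + (a : ℤ) < N then (1 : ℝ)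
    else 0) N, Finset.sum_boole, sub_le_iff_le_add]
  norm_cast
  -- One of `k.toNat`, `(-k).toNat` is zero, so this interval has length `N - |k|`, truncated at
  -- zero.
  have hsub : Finset.Ico (-k).toNat (N - k.toNat) ⊆
      (Finset.range N).filter fun a : ℕ => 0 ≤ k + (a : ℤ) ∧ k + (a : ℤ) < N := fun a ha => by
    rw [Finset.mem_Ico] at ha
    rw [Finset.mem_filter, Finset.mem_range]
    omega
  have := Finset.card_le_card hsub
  rw [Nat.card_Ico] at this
  omega

lemma tendsto_shiftCount_div (k : ℤ) :
    Tendsto (fun N : ℕ => (∑ a : Fin N, ∑ b : Fin N,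
      if k + ((a : ℤ) - (b : ℤ)) = 0 then (1 : ℝ) else 0) / N) atTop (𝓝 1) := by
  simp_rw [sum_ite_add_sub_eq_zero]
  have hlim : Tendsto (fun N : ℕ => 1 - (k.natAbs : ℝ) / N) atTop (𝓝 1) := by
    simpa using tendsto_const_nhds.sub (tendsto_const_div_atTop_nhds_zero_nat (k.natAbs : ℝ))
  refine tendsto_of_tendsto_of_tendsto_of_le_of_le' hlim tendsto_const_nhds ?_ ?_
  · filter_upwards [eventually_gt_atTop 0] with N hN
    have hN' : (0 : ℝ) < N := by exact_mod_cast hN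
    rw [le_div_iff₀ hN', sub_mul, one_mul, div_mul_cancel₀ _ hN'.ne']
    exact sub_natAbs_le_shiftCount N k
  · refine Eventually.of_forall fun N => div_le_one_of_le₀ ?_ N.cast_nonneg
    calc _ ≤ ∑ _a : Fin N, (1 : ℝ) := Finset.sum_le_sum fun a _ => by split_ifs <;> simp
      _ = N := by simp

lemma tendsto_boxCount_div (γ : Fin n → ℤ) :
    Tendsto (fun N : ℕ => boxCount N γ / (N : ℝ) ^ n) atTop (𝓝 1) := by
  have h := tendsto_finsetProd (Finset.univ : Finset (Fin n)) fun i _ =>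
    tendsto_shiftCount_div (γ i)
  simpa [boxCount_eq_prod, Finset.prod_div_distrib] using h

/-- After division by `N ^ n` the Fejér weights tend to `1` on the finite support of `p`, so
nonnegativity passes to the limit. -/
theorem isPositiveSeq_of_toeplitz_posSemidef {y : (Fin n → ℤ) → ℂ}
    (hy : ∀ d, (toeplitz d y).PosSemidef) : IsPositiveSeq y := fun p hp => by
  have hlim : Tendsto (fun N : ℕ => ∑ γ ∈ p.support,
      (p γ * y γ).re * (boxCount N γ / (N : ℝ) ^ n)) atTop (𝓝 (∑ γ ∈ p.support,
      (p γ * y γ).re * 1)) :=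
    tendsto_finsetSum _ fun γ _ => (tendsto_boxCount_div γ).const_mul _
  have hre : (riesz y p).re = ∑ γ ∈ p.support, (p γ * y γ).re * 1 := by
    simp [riesz, Finsupp.linearCombination_apply, Finsupp.sum]
  rw [hre]
  refine ge_of_tendsto' hlim fun N => ?_
  have h := re_sum_boxCount_nonneg hy hp N
  rw [Complex.re_sum] at h
  simp only [Complex.re_mul_ofReal] at h
  simp only [mul_div_assoc', ← Finset.sum_div]
  positivity

/-! ### Compactness and limits of the semidefinite programs. -/

lemma norm_le_re_zero_of_toeplitz_posSemidef {d : ℕ} {y : (Fin n → ℤ) → ℂ}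
    (hy : (toeplitz d y).PosSemidef) {γ : Fin n → ℤ} (hγ : l1 γ ≤ d) : ‖y γ‖ ≤ (y 0).re := by
  have hpos : ∑ i, (γ i).toNat ≤ d :=
    (Finset.sum_le_sum fun i _ => by omega).trans hγ
  have hneg : ∑ i, (-γ i).toNat ≤ d :=
    (Finset.sum_le_sum fun i _ => by omega).trans hγ
  set α : MultiIdx n d := ⟨fun i => (-γ i).toNat, hneg⟩
  set β : MultiIdx n d := ⟨fun i => (γ i).toNat, hpos⟩
  have e1 : idxSub β α = γ := by
    ext i
    simp only [idxSub, α, β]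
    omega
  have e0 : ∀ κ : MultiIdx n d, idxSub κ κ = 0 := fun κ => by ext i; simp [idxSub]
  have hy0 : 0 ≤ y 0 := by
    have := hy.diag_nonneg (i := α)
    rwa [toeplitz, Matrix.of_apply, e0] at this
  have hH : y (idxSub α β) = star (y γ) := by
    have := hy.1.apply β α
    simp only [toeplitz, Matrix.of_apply, e1] at this
    exact this.symm
  -- The principal minor on the negative and positive parts of `γ` reads `y₀² - |y_γ|² ≥ 0`.
  have hdet := (hy.submatrix ![α, β]).det_nonneg
  rw [Matrix.det_fin_two] at hdet
  simp only [toeplitz, Matrix.submatrix_apply, Matrix.of_apply, Matrix.cons_val_zero,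
    Matrix.cons_val_one, e0, e1, hH] at hdet
  rw [Complex.nonneg_iff] at hdet hy0
  have h1 : (y γ * star (y γ)).re = ‖y γ‖ ^ 2 := by
    rw [Complex.star_def, Complex.mul_conj, Complex.normSq_eq_norm_sq, Complex.ofReal_re]
  have h2 := hdet.1
  rw [Complex.sub_re, h1, Complex.mul_re, ← hy0.2] at h2
  exact abs_le_of_sq_le_sq' (by nlinarith) hy0.1 |>.2

instance finite_multiIdx (n d : ℕ) : Finite (MultiIdx n d) :=
  Finite.of_injective (fun α : MultiIdx n d => fun i => (⟨α.1 i, Nat.lt_succ_of_le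
    ((Finset.single_le_sum (fun _ _ => Nat.zero_le _) (Finset.mem_univ i)).trans α.2)⟩ :
      Fin (d + 1))) fun α β h => by
    ext i
    simpa using congrFun h i

lemma isClosed_setOf_posSemidef {ι : Type*} [Finite ι] :
    IsClosed {M : Matrix ι ι ℂ | M.PosSemidef} := by
  have := Fintype.ofFinite ι
  have h : {M : Matrix ι ι ℂ | M.PosSemidef} = {M : Matrix ι ι ℂ | M.conjTranspose = M} ∩
      ⋂ x : ι → ℂ, {M | 0 ≤ star x ⬝ᵥ M.mulVec x} := by
    ext M
    simp [Matrix.posSemidef_iff_dotProduct_mulVec, Matrix.IsHermitian]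
  rw [h]
  refine (isClosed_eq continuous_id.matrix_conjTranspose continuous_id).inter
    (isClosed_iInter fun x => isClosed_le continuous_const ?_)
  exact continuous_const.dotProduct (continuous_id.matrix_mulVec continuous_const)

lemma toeplitz_posSemidef_of_tendsto {F : Filter ℕ} [F.NeBot] (hF : F ≤ atTop)
    {y : ℕ → (Fin n → ℤ) → ℂ} {a : (Fin n → ℤ) → ℂ}
    (hy : ∀ᶠ d in atTop, (toeplitz d (y d)).PosSemidef)
    (hlim : ∀ γ, Tendsto (fun d => y d γ) F (𝓝 (a γ))) (k : ℕ) : (toeplitz k a).PosSemidef := by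
  have ht : Tendsto (fun d => toeplitz k (y d)) F (𝓝 (toeplitz k a)) :=
    tendsto_pi_nhds.2 fun α => tendsto_pi_nhds.2 fun β => hlim _
  refine isClosed_setOf_posSemidef.mem_of_tendsto ht (hF ?_)
  filter_upwards [hy, eventually_ge_atTop k] with d hd hk
  exact toeplitz_posSemidef_of_le hk hd

/-- Each entry is eventually bounded by `S`, so an ultrafilter gives all limits simultaneously,
without diagonal extraction. -/
lemma exists_ultrafilter_limit {U : Ultrafilter ℕ} (hU : (U : Filter ℕ) ≤ atTop)
    {y : ℕ → (Fin n → ℤ) → ℂ} {S : ℝ} (hy : ∀ᶠ d in atTop, (toeplitz d (y d)).PosSemidef)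
    (hS : ∀ᶠ d in atTop, (y d 0).re ≤ S) :
    ∃ a : (Fin n → ℤ) → ℂ, (∀ γ, Tendsto (fun d => y d γ) U (𝓝 (a γ))) ∧ IsPositiveSeq a := by
  have h : ∀ γ : Fin n → ℤ, ∃ a, Tendsto (fun d => y d γ) U (𝓝 a) := fun γ => by
    have hb : ∀ᶠ d in (U : Filter ℕ), y d γ ∈ Metric.closedBall (0 : ℂ) S := hU <| by
      filter_upwards [hy, hS, eventually_ge_atTop (l1 γ)] with d h1 h2 h3
      rw [mem_closedBall_zero_iff]
      exact (norm_le_re_zero_of_toeplitz_posSemidef h1 h3).trans h2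
    obtain ⟨a, -, ha⟩ := (isCompact_closedBall (0 : ℂ) S).ultrafilter_le_nhds
      (U.map fun d => y d γ) (le_principal_iff.2 hb)
    exact ⟨a, ha⟩
  choose a ha using h
  exact ⟨a, ha, isPositiveSeq_of_toeplitz_posSemidef (toeplitz_posSemidef_of_tendsto hU hy ha)⟩

lemma exists_idxSub_eq {e : ℕ} {γ : Fin n → ℤ} (hγ : l1 γ ≤ e) :
    ∃ α β : MultiIdx n e, idxSub α β = γ := by
  refine ⟨⟨fun i => (γ i).toNat, (Finset.sum_le_sum fun i _ => by omega).trans hγ⟩,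
    ⟨fun i => (-γ i).toNat, (Finset.sum_le_sum fun i _ => by omega).trans hγ⟩, ?_⟩
  ext i
  simp only [idxSub]
  omega

/-- Each atom contributes a nonnegative multiple of a rank-one matrix. -/
lemma toeplitz_atomicMoment_posSemidef (d : ℕ) (Ξ : Finset (Torus n)) {c : Torus n → ℝ}
    (hc : ∀ ξ ∈ Ξ, 0 ≤ c ξ) : (toeplitz d (atomicMoment Ξ c)).PosSemidef := by
  have : toeplitz d (atomicMoment Ξ c) = ∑ ξ ∈ Ξ, (c ξ : ℂ) • Matrix.vecMulVec
      (star fun α : MultiIdx n d => mono (fun i => (α.1 i : ℤ)) ξ)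
      (fun α : MultiIdx n d => mono (fun i => (α.1 i : ℤ)) ξ) := by
    ext α β
    simp only [toeplitz, atomicMoment, Matrix.of_apply, Matrix.sum_apply, Matrix.smul_apply,
      Matrix.vecMulVec_apply, smul_eq_mul, Pi.star_apply]
    refine Finset.sum_congr rfl fun ξ _ => ?_
    rw [← Pi.star_apply, star_mono, ← Pi.mul_apply, ← mono_add]
    congr 2
    ext i
    simp [idxSub, sub_eq_neg_add]
  rw [this]
  refine Matrix.posSemidef_sum _ fun ξ hξ => ?_
  exact (Matrix.posSemidef_vecMulVec_star_self _).smul (by exact_mod_cast hc ξ hξ)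

/-- The competitor is the pair of moment sequences of the positive and negative parts of the
weights. -/
lemma IsOptimalSDP.re_le {σ : (Fin n → ℤ) → ℂ} {d e : ℕ} {yp ym : (Fin n → ℤ) → ℂ}
    (h : IsOptimalSDP σ d e yp ym) {Ξ : Finset (Torus n)} {c : Torus n → ℝ}
    (hσ : ∀ γ, σ γ = atomicMoment Ξ c γ) : (yp 0 + ym 0).re ≤ ∑ ξ ∈ Ξ, |c ξ| := by
  have h1 := h.2 (atomicMoment Ξ fun ξ => (c ξ)⁺) (atomicMoment Ξ fun ξ => (c ξ)⁻)
    ⟨fun α β => ?_, toeplitz_atomicMoment_posSemidef d Ξ fun ξ _ => posPart_nonneg _,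
      toeplitz_atomicMoment_posSemidef d Ξ fun ξ _ => negPart_nonneg _⟩
  · refine h1.trans_eq ?_
    simp only [atomicMoment, mono_zero, ← Finset.sum_add_distrib, Complex.re_sum]
    refine Finset.sum_congr rfl fun ξ _ => ?_
    simp [← posPart_add_negPart]
  · rw [hσ, atomicMoment, atomicMoment, ← Finset.sum_sub_distrib]
    refine Finset.sum_congr rfl fun ξ _ => ?_
    rw [← sub_mul, ← Complex.ofReal_sub, posPart_sub_negPart]

/-- Along any ultrafilter the two limits are positive, match the data up to degree `D` and inherit
the mass bound, so rigidity identifies their difference independently of the ultrafilter. -/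
theorem tendsto_of_isOptimalSDP {Ξ P : Finset (Torus n)} {D e : ℕ} {q : Torus n → ℝ}
    {c : Torus n → ℝ} (hq : IsCertificate Ξ P D q) (hP : P ⊆ Ξ)
    (hpos : ∀ ξ ∈ P, 0 ≤ c ξ) (hneg : ∀ ξ ∈ Ξ, ξ ∉ P → c ξ ≤ 0)
    {u : Torus n → Torus n → ℂ} (hu : IsInterpolationFamily Ξ u)
    (huD : ∀ ξ ∈ Ξ, u ξ ∈ laurentPoly n D) {σ : (Fin n → ℤ) → ℂ}
    (hσ : ∀ γ, σ γ = atomicMoment Ξ c γ) (hDe : D ≤ e) {yp ym : ℕ → (Fin n → ℤ) → ℂ}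
    (hopt : ∀ d, e ≤ d → IsOptimalSDP σ d e (yp d) (ym d)) (α : Fin n → ℤ) :
    Tendsto (fun d => yp d α - ym d α) atTop (𝓝 (σ α)) := by
  rw [tendsto_iff_ultrafilter]
  intro U hU
  have hle : ∀ᶠ d in atTop, ((yp d 0) + (ym d 0)).re ≤ ∑ ξ ∈ Ξ, |c ξ| := by
    filter_upwards [eventually_ge_atTop e] with d hd using (hopt d hd).re_le hσ
  have hp : ∀ᶠ d in atTop, (toeplitz d (yp d)).PosSemidef := by
    filter_upwards [eventually_ge_atTop e] with d hd using (hopt d hd).1.2.1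
  have hm : ∀ᶠ d in atTop, (toeplitz d (ym d)).PosSemidef := by
    filter_upwards [eventually_ge_atTop e] with d hd using (hopt d hd).1.2.2
  have h0 : ∀ {y : (Fin n → ℤ) → ℂ} {d}, (toeplitz d y).PosSemidef → 0 ≤ (y 0).re := fun hy =>
    (norm_nonneg _).trans (norm_le_re_zero_of_toeplitz_posSemidef hy (γ := 0) (by simp [l1_zero]))
  obtain ⟨a, ha, hapos⟩ := exists_ultrafilter_limit hU hp (S := ∑ ξ ∈ Ξ, |c ξ|) <| by
    filter_upwards [hle, hm] with d h1 h2
    rw [Complex.add_re] at h1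
    linarith [h0 h2]
  obtain ⟨b, hb, hbpos⟩ := exists_ultrafilter_limit hU hm (S := ∑ ξ ∈ Ξ, |c ξ|) <| by
    filter_upwards [hle, hp] with d h1 h2
    rw [Complex.add_re] at h1
    linarith [h0 h2]
  rw [hσ, ← hq.eq_atomicMoment hP hpos hneg hu huD hapos hbpos ?_ ?_ α]
  · exact (ha α).sub (hb α)
  · intro γ hγ
    refine tendsto_nhds_unique_of_eventuallyEq ((ha γ).sub (hb γ)) tendsto_const_nhds (hU ?_)
    filter_upwards [eventually_ge_atTop e] with d hd
    obtain ⟨α, β, rfl⟩ := exists_idxSub_eq (hγ.trans hDe)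
    rw [(hopt d hd).1.1 α β, hσ]
  · exact le_of_tendsto ((Complex.continuous_re.tendsto _).comp ((ha 0).add (hb 0))) (hU hle)

/-! ### Signed measures, their moments and total variation. -/

lemma integrable_of_continuous {f : Torus n → ℂ} (hf : Continuous f) (μ : Measure (Torus n))
    [IsFiniteMeasure μ] : Integrable f μ :=
  hf.integrable_of_hasCompactSupport (HasCompactSupport.of_compactSpace _)

lemma riesz_integral (μ : Measure (Torus n)) [IsFiniteMeasure μ] (p : (Fin n → ℤ) →₀ ℂ) :
    riesz (fun γ => ∫ z, mono γ z ∂μ) p = ∫ z, laurentEval p z ∂μ := by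
  induction p using Finsupp.induction_linear with
  | zero => simp
  | add p q hp hq =>
    simp only [map_add, hp, hq, Pi.add_apply]
    rw [integral_add (integrable_of_continuous (continuous_laurentEval p) μ)
      (integrable_of_continuous (continuous_laurentEval q) μ)]
  | single γ a =>
    rw [riesz_single, laurentEval_single]
    simp only [Pi.smul_apply, smul_eq_mul, integral_const_mul]

lemma isPositiveSeq_integral (μ : Measure (Torus n)) [IsFiniteMeasure μ] :
    IsPositiveSeq fun γ => ∫ z, mono γ z ∂μ := fun p hp => by
  rw [riesz_integral]
  have := integral_re (integrable_of_continuous (continuous_laurentEval p) μ)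
  simp only [RCLike.re_eq_complex_re] at this
  rw [← this]
  exact integral_nonneg hp

/-- The bounded continuous functions on the torus that are Laurent polynomials. -/
noncomputable def laurentStarSubalgebra (n : ℕ) :
    StarSubalgebra ℂ (BoundedContinuousFunction (Torus n) ℂ) where
  carrier := {f | ∃ D, ⇑f ∈ laurentPoly n D}
  mul_mem' := fun ⟨a, ha⟩ ⟨b, hb⟩ => ⟨a + b, mul_mem_laurentPoly ha hb⟩
  add_mem' := fun ⟨a, ha⟩ ⟨b, hb⟩ => ⟨max a b, add_mem (laurentPoly_mono (le_max_left _ _) ha)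
    (laurentPoly_mono (le_max_right _ _) hb)⟩
  algebraMap_mem' := fun c => ⟨0, const_mem_laurentPoly c 0⟩
  star_mem' := fun ⟨a, ha⟩ => ⟨a, star_mem_laurentPoly ha⟩

theorem measure_ext_of_integral_mono {μ ν : Measure (Torus n)} [IsFiniteMeasure μ]
    [IsFiniteMeasure ν] (h : ∀ γ : Fin n → ℤ, ∫ z, mono γ z ∂μ = ∫ z, mono γ z ∂ν) : μ = ν := by
  refine ext_of_forall_mem_subalgebra_integral_eq_of_pseudoEMetric_complete_countable
    (A := laurentStarSubalgebra n) (𝕜 := ℂ) ?_ ?_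
  · intro x y hxy
    obtain ⟨f, hf, hx, hy⟩ := exists_separating_laurentPoly hxy
    refine ⟨f, ⟨⟨f, continuous_of_mem_laurentPoly hf⟩, ⟨BoundedContinuousFunction.mkOfCompact
      ⟨f, continuous_of_mem_laurentPoly hf⟩, ⟨1, hf⟩, ?_⟩, rfl⟩, by simp [hx, hy]⟩
    ext z
    rfl
  · rintro f ⟨D, hf⟩
    obtain ⟨p, hp, -⟩ := exists_laurentEval_eq hf
    rw [← hp, ← riesz_integral, ← riesz_integral]
    exact riesz_eq_of_eqOn fun γ _ => h γ

lemma integral_mono_signed (ν : SignedMeasure (Torus n)) (γ : Fin n → ℤ) :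
    moment ν γ = ∫ z, mono γ z ∂ν.toJordanDecomposition.posPart -
      ∫ z, mono γ z ∂ν.toJordanDecomposition.negPart := by
  have hi : ∀ (μ : Measure (Torus n)) [IsFiniteMeasure μ],
      μ.toSignedMeasure.Integrable (mono γ) := fun μ _ => by
    rw [VectorMeasure.Integrable, Measure.variation_toSignedMeasure]
    exact integrable_of_continuous (continuous_mono γ) μ
  conv_lhs => rw [← ν.toSignedMeasure_toJordanDecomposition]
  rw [moment, JordanDecomposition.toSignedMeasure,
    VectorMeasure.integral_sub_vectorMeasure (hi _) (hi _),
    VectorMeasure.integral_toSignedMeasure, VectorMeasure.integral_toSignedMeasure]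

theorem signedMeasure_ext_of_moment {μ ν : SignedMeasure (Torus n)}
    (h : ∀ γ, moment μ γ = moment ν γ) : μ = ν := by
  set a := μ.toJordanDecomposition with ha
  set b := ν.toJordanDecomposition with hb
  -- Moving the negative parts across reduces the claim to positive measures.
  have key : a.posPart + b.negPart = b.posPart + a.negPart :=
    measure_ext_of_integral_mono fun γ => by
      have hi : ∀ (μ : Measure (Torus n)) [IsFiniteMeasure μ], Integrable (mono γ) μ :=
        fun μ _ => integrable_of_continuous (continuous_mono γ) μ
      rw [integral_add_measure (hi _) (hi _), integral_add_measure (hi _) (hi _)]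
      have := h γ
      rw [integral_mono_signed, integral_mono_signed, ← ha, ← hb] at this
      linear_combination this
  ext s hs
  rw [μ.apply_eq_posPart_real_sub_negPart_real hs, ν.apply_eq_posPart_real_sub_negPart_real hs,
    ← ha, ← hb]
  have : (a.posPart + b.negPart).real s = (b.posPart + a.negPart).real s := by rw [key]
  rw [measureReal_add_apply, measureReal_add_apply] at this
  linarith

lemma tvNorm_eq (ν : SignedMeasure (Torus n)) :
    tvNorm ν = ν.toJordanDecomposition.posPart.real Set.univ +
      ν.toJordanDecomposition.negPart.real Set.univ := by
  rw [tvNorm, SignedMeasure.totalVariation, ← measureReal_def, measureReal_add_apply]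

lemma tvNorm_eq_re (ν : SignedMeasure (Torus n)) :
    (∫ z, mono 0 z ∂ν.toJordanDecomposition.posPart +
      ∫ z, mono 0 z ∂ν.toJordanDecomposition.negPart).re = tvNorm ν := by
  rw [tvNorm_eq, mono_zero]
  simp

/-- Hahn decomposition: `S` is null for the positive part and `Sᶜ` for the negative part. -/
lemma exists_tvNorm_eq_sub (ν : SignedMeasure (Torus n)) :
    ∃ S, MeasurableSet S ∧ tvNorm ν = ν Sᶜ - ν S := by
  obtain ⟨S, hS, -, -, hp, hm⟩ := ν.toJordanDecomposition.exists_compl_positive_negative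
  refine ⟨S, hS, ?_⟩
  rw [tvNorm_eq, ν.apply_eq_posPart_real_sub_negPart_real hS,
    ν.apply_eq_posPart_real_sub_negPart_real hS.compl, ← measureReal_add_measureReal_compl hS,
    ← measureReal_add_measureReal_compl hS]
  simp only [measureReal_def, hp, hm]
  simp

lemma atomicMeasure_apply (g : MvPolynomial (Fin n) ℝ) (φ : Torus n) {S : Set (Torus n)}
    (hS : MeasurableSet S) : atomicMeasure g φ S =
      ∑ β ∈ g.support, g.coeff β * (Measure.dirac (node φ β)).real S := by
  rw [atomicMeasure, FunLike.coe_sum, Finset.sum_apply]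
  refine Finset.sum_congr rfl fun β _ => ?_
  rw [FunLike.coe_smul, Pi.smul_apply, Measure.toSignedMeasure_apply_measurable hS,
    smul_eq_mul]

/-- Only this inequality is checked directly, and it holds even if nodes coincide; the reverse one
will follow from weak duality. -/
lemma tvNorm_atomicMeasure_le (g : MvPolynomial (Fin n) ℝ) (φ : Torus n) :
    tvNorm (atomicMeasure g φ) ≤ ∑ β ∈ g.support, |g.coeff β| := by
  obtain ⟨S, hS, h⟩ := exists_tvNorm_eq_sub (atomicMeasure g φ)
  rw [h, atomicMeasure_apply g φ hS, atomicMeasure_apply g φ hS.compl, ← Finset.sum_sub_distrib]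
  refine Finset.sum_le_sum fun β _ => ?_
  rw [← mul_sub]
  refine (le_abs_self _).trans ?_
  rw [abs_mul]
  refine mul_le_of_le_one_right (abs_nonneg _) ?_
  have h1 := probReal_compl_eq_one_sub (μ := Measure.dirac (node φ β)) hS
  have h2 : (Measure.dirac (node φ β)).real S ≤ 1 := measureReal_le_one
  have h3 : 0 ≤ (Measure.dirac (node φ β)).real S := measureReal_nonneg
  rw [abs_le]
  constructor <;> linarith

lemma moment_atomicMeasure (g : MvPolynomial (Fin n) ℝ) (φ : Torus n) (γ : Fin n → ℤ) :
    moment (atomicMeasure g φ) γ = ∑ β ∈ g.support, ((g.coeff β : ℝ) : ℂ) * mono γ (node φ β) := by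
  have hi : ∀ β ∈ g.support,
      (g.coeff β • (Measure.dirac (node φ β)).toSignedMeasure).Integrable (mono γ) := fun β _ => by
    refine VectorMeasure.Integrable.smul_vectorMeasure ?_ _
    rw [VectorMeasure.Integrable, Measure.variation_toSignedMeasure]
    exact integrable_of_continuous (continuous_mono γ) _
  rw [moment, atomicMeasure, VectorMeasure.integral_finsetSum_vectorMeasure hi]
  refine Finset.sum_congr rfl fun β _ => ?_
  rw [VectorMeasure.integral_smul_vectorMeasure, VectorMeasure.integral_toSignedMeasure,
    integral_dirac' _ _ (continuous_mono γ).stronglyMeasurable, Complex.real_smul]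

/-! ### The data of `g` as moments of an atomic measure on distinct nodes. -/

lemma sigma_eq (g : MvPolynomial (Fin n) ℝ) (φ : Torus n) (γ : Fin n → ℤ) :
    sigma g φ γ = ∑ β ∈ g.support, ((g.coeff β : ℝ) : ℂ) * mono γ (node φ β) := by
  rw [sigma, MvPolynomial.aeval_def, MvPolynomial.eval₂_eq']
  refine Finset.sum_congr rfl fun β _ => ?_
  congr 1
  refine Finset.prod_congr rfl fun i _ => ?_
  -- The symmetry `(φ^γ)^β = (φ^β)^γ` turns evaluations of `g` into moments.
  rw [node, Circle.coe_pow, ← zpow_natCast, ← zpow_natCast, zpow_comm]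

/-- For roots of unity, equal nodes give exponents congruent modulo `N i` and both in `[0, |N i|)`;
in the other case distinct exponents would make `θ i` rational. -/
lemma node_injOn {g : MvPolynomial (Fin n) ℝ} {φ : Torus n} (h : IsAdmissible g φ) :
    Set.InjOn (node φ) (g.support : Set (Fin n →₀ ℕ)) := by
  intro β hβ β' hβ' heq
  ext i
  have hi : (φ i : ℂ) ^ β i = (φ i : ℂ) ^ β' i := by
    rw [← Circle.coe_pow, ← Circle.coe_pow]
    exact congrArg _ (congrFun heq i)
  have h2 : (2 * Complex.I * Real.pi : ℂ) ≠ 0 := by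
    simp [Real.pi_ne_zero, Complex.I_ne_zero]
  rcases h with ⟨N, hN, hlt, hφ⟩ | ⟨θ, hθ, hφ⟩
  · rw [hφ, ← Complex.exp_nat_mul, ← Complex.exp_nat_mul, Complex.exp_eq_exp_iff_exists_int] at hi
    obtain ⟨m, hm⟩ := hi
    have hNc : (N i : ℂ) ≠ 0 := by exact_mod_cast hN i
    field_simp at hm
    have hm' : ((β i : ℤ) : ℂ) = ((β' i + m * N i : ℤ) : ℂ) := by
      push_cast
      linear_combination hm
    have hz : (β i : ℤ) = β' i + m * N i := by exact_mod_cast hm'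
    have h3 := hlt β hβ i
    have h4 := hlt β' hβ' i
    have h5 : (β i : ℤ) - β' i = 0 := by
      refine Int.eq_zero_of_abs_lt_dvd (m := |N i|) ?_ ?_
      · rw [abs_dvd]
        exact ⟨m, by rw [hz]; ring⟩
      · rw [abs_lt]
        constructor <;> omega
    omega
  · rw [hφ, ← Complex.exp_nat_mul, ← Complex.exp_nat_mul, Complex.exp_eq_exp_iff_exists_int] at hi
    obtain ⟨m, hm⟩ := hi
    have hm' : ((β i * θ i : ℝ) : ℂ) = ((β' i * θ i + m : ℝ) : ℂ) := by
      push_cast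
      refine mul_left_cancel₀ h2 ?_
      linear_combination hm
    have hr : (β i : ℝ) * θ i = β' i * θ i + m := by exact_mod_cast hm'
    by_contra hne
    have hne' : (((β i : ℤ) - β' i : ℤ) : ℝ) ≠ 0 :=
      Int.cast_ne_zero.2 (by omega)
    refine hθ i ⟨(m : ℚ) / ((β i : ℤ) - β' i : ℤ), ?_⟩
    rw [Rat.cast_div, Rat.cast_intCast, Rat.cast_intCast, div_eq_iff hne']
    push_cast
    linear_combination -hr

open scoped Classical in
/-- The weight that the atomic measure of `g` puts on the point `ξ`. -/
noncomputable def weight (g : MvPolynomial (Fin n) ℝ) (φ ξ : Torus n) : ℝ :=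
  ∑ β ∈ g.support with node φ β = ξ, g.coeff β

lemma weight_node {g : MvPolynomial (Fin n) ℝ} {φ : Torus n} (h : IsAdmissible g φ)
    {β : Fin n →₀ ℕ} (hβ : β ∈ g.support) : weight g φ (node φ β) = g.coeff β := by
  classical
  rw [weight, Finset.sum_eq_single_of_mem β (by simpa using hβ)]
  intro β' hβ' hne
  rw [Finset.mem_filter] at hβ'
  exact absurd (node_injOn h hβ'.1 hβ hβ'.2) hne

lemma sum_nodes {M : Type*} [AddCommMonoid M] {g : MvPolynomial (Fin n) ℝ} {φ : Torus n}
    (h : IsAdmissible g φ) (f : Torus n → M) :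
    ∑ ξ ∈ nodes g φ, f ξ = ∑ β ∈ g.support, f (node φ β) := by
  classical
  rw [nodes, Finset.sum_image (node_injOn h)]

lemma card_nodes {g : MvPolynomial (Fin n) ℝ} {φ : Torus n} (h : IsAdmissible g φ) :
    (nodes g φ).card = g.support.card := by
  classical
  rw [nodes, Finset.card_image_of_injOn (node_injOn h)]

lemma sigma_eq_atomicMoment {g : MvPolynomial (Fin n) ℝ} {φ : Torus n} (h : IsAdmissible g φ)
    (γ : Fin n → ℤ) : sigma g φ γ = atomicMoment (nodes g φ) (weight g φ) γ := by
  rw [sigma_eq, atomicMoment, sum_nodes h]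
  exact Finset.sum_congr rfl fun β hβ => by rw [weight_node h hβ]

lemma sum_abs_weight {g : MvPolynomial (Fin n) ℝ} {φ : Torus n} (h : IsAdmissible g φ) :
    ∑ ξ ∈ nodes g φ, |weight g φ ξ| = ∑ β ∈ g.support, |g.coeff β| := by
  rw [sum_nodes h]
  exact Finset.sum_congr rfl fun β hβ => by rw [weight_node h hβ]

end SuperRes

/-! ### Assembly. -/

theorem lemma3p6 (r : ℕ) :
    ∃ C : ℝ, 0 < C ∧
      ∀ (n : ℕ) (g : MvPolynomial (Fin n) ℝ) (φ : SuperRes.Torus n) (𝔡 : ℕ),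
        g.support.card = r →
        SuperRes.IsAdmissible g φ →
        C * SuperRes.entropy (SuperRes.nodes g φ) ≤ (𝔡 : ℝ) →
        ∃ μ : SignedMeasure (SuperRes.Torus n),
          SuperRes.IsOptimalTV (SuperRes.sigma g φ) 𝔡 μ ∧
          (∀ ν : SignedMeasure (SuperRes.Torus n),
            SuperRes.IsOptimalTV (SuperRes.sigma g φ) 𝔡 ν → ν = μ) ∧
          μ = SuperRes.atomicMeasure g φ ∧
          SuperRes.tvNorm μ = ∑ β ∈ g.support, |g.coeff β| ∧
          ∀ (e : ℕ), 𝔡 ≤ e →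
            ∀ (yp ym : ℕ → (Fin n → ℤ) → ℂ),
              (∀ d : ℕ, e ≤ d →
                SuperRes.IsOptimalSDP (SuperRes.sigma g φ) d e (yp d) (ym d)) →
              ∀ α : Fin n → ℤ,
                Tendsto (fun d : ℕ => yp d α - ym d α) atTop (𝓝 (SuperRes.moment μ α)) := by
  classical
  -- The constant of `exists_certificate_of_entropy_le`; the summand `1` keeps it positive when `r =
  -- 0`.
  refine ⟨8 * (r : ℝ) ^ 2 + 12 * r + 1, by positivity, ?_⟩
  intro n g φ D hr hφ hD
  rw [← hr, ← SuperRes.card_nodes hφ] at hD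
  set Ξ := SuperRes.nodes g φ with hΞ
  set c := SuperRes.weight g φ with hc
  set P := Ξ.filter fun ξ => 0 ≤ c ξ with hPdef
  have hP : P ⊆ Ξ := Finset.filter_subset _ _
  have hpos : ∀ ξ ∈ P, 0 ≤ c ξ := fun ξ hξ => (Finset.mem_filter.1 hξ).2
  have hneg : ∀ ξ ∈ Ξ, ξ ∉ P → c ξ ≤ 0 := fun ξ hξ hξP =>
    le_of_not_ge fun h => hξP (Finset.mem_filter.2 ⟨hξ, h⟩)
  obtain ⟨⟨q, hq⟩, u, hu, huD⟩ := SuperRes.exists_certificate_of_entropy_le hP hD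
  have hσ : ∀ γ, SuperRes.sigma g φ γ = SuperRes.atomicMoment Ξ c γ :=
    SuperRes.sigma_eq_atomicMoment hφ
  have hmom : ∀ γ, SuperRes.moment (SuperRes.atomicMeasure g φ) γ = SuperRes.sigma g φ γ :=
    fun γ => by rw [SuperRes.moment_atomicMeasure, SuperRes.sigma_eq]
  have hsum : ∑ ξ ∈ Ξ, |c ξ| = ∑ β ∈ g.support, |g.coeff β| := SuperRes.sum_abs_weight hφ
  have hfeas : ∀ ν : SignedMeasure (SuperRes.Torus n),
      SuperRes.IsFeasibleTV (SuperRes.sigma g φ) D ν → ∀ γ, SuperRes.l1 γ ≤ D →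
        ∫ z, SuperRes.mono γ z ∂ν.toJordanDecomposition.posPart -
          ∫ z, SuperRes.mono γ z ∂ν.toJordanDecomposition.negPart = SuperRes.atomicMoment Ξ c γ :=
    fun ν hν γ hγ => by rw [← SuperRes.integral_mono_signed, hν γ hγ, hσ]
  have hlower : ∀ ν : SignedMeasure (SuperRes.Torus n),
      SuperRes.IsFeasibleTV (SuperRes.sigma g φ) D ν →
        ∑ β ∈ g.support, |g.coeff β| ≤ SuperRes.tvNorm ν := fun ν hν => by
    rw [← hsum, ← SuperRes.tvNorm_eq_re]
    exact hq.sum_abs_le hpos hneg (SuperRes.isPositiveSeq_integral _)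
      (SuperRes.isPositiveSeq_integral _) (hfeas ν hν)
  have hupper := SuperRes.tvNorm_atomicMeasure_le g φ
  have hfeas0 : SuperRes.IsFeasibleTV (SuperRes.sigma g φ) D (SuperRes.atomicMeasure g φ) :=
    fun γ _ => hmom γ
  refine ⟨SuperRes.atomicMeasure g φ, ⟨hfeas0, fun ν hν => hupper.trans (hlower ν hν)⟩, ?_, rfl,
    le_antisymm hupper (hlower _ hfeas0), ?_⟩
  · intro ν hν
    refine SuperRes.signedMeasure_ext_of_moment fun γ => ?_
    rw [SuperRes.integral_mono_signed, hmom, hσ]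
    refine hq.eq_atomicMoment hP hpos hneg hu huD (SuperRes.isPositiveSeq_integral _)
      (SuperRes.isPositiveSeq_integral _) (hfeas ν hν.1) ?_ γ
    rw [SuperRes.tvNorm_eq_re, hsum]
    exact (hν.2 _ hfeas0).trans hupper
  · intro e he yp ym hopt α
    -- The atomic measure has moment `σ_α` for every `α`, not only up to degree `𝔡`, so the limit
    -- sought is `σ_α`.
    rw [hmom]
    exact SuperRes.tendsto_of_isOptimalSDP hq hP hpos hneg hu huD hσ he hopt α
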